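/- Let $\mathfrak m\in\mathbb R$, $\mathfrak m^+>0$ and $L,R\ge 0$. Then there exist $\bar\gamma>0$, $0\le\lambda_{\bar\gamma}\le\rho_{\bar\gamma}<1$ and $D_{\bar\gamma,1},D_{\bar\gamma,2},E_{\bar\gamma},E_{\bar\gamma,1},E_{\bar\gamma,2}\ge 0$, and for every integer $p\ge1$ and every $\alpha\in(p,+\infty)$ a constant $E_{\bar\gamma,\alpha}\ge0$ (which may also depend on $p$), all depending only on $\mathfrak m,\mathfrak m^+,L,R$ (and, for the last one, on $p,\alpha$), such that the following holds. Let $\mathbb R^d$ be equipped with a scalar product $\langle\cdot,\cdot\rangle$ and its norm $\|\cdot\|$, and let $b:\mathbb R^d\to\mathbb R^d$ satisfy, for all $x,y\in\mathbb R^d$, $$\|b(x)-b(y)\|\le L\|x-y\|,\qquad \langle b(x)-b(y),x-y\rangle\le-\mathfrak m\|x-y\|^2,$$ and, if $\|x-y\|\ge R$, $$\langle b(x)-b(y),x-y\rangle\le-\mathfrak m^+\|x-y\|^2 .$$ For $\gamma>0$ let $\mathrm R_\gamma$ be the Markov kernel of the Euler–Maruyama recursion $X_{k+1}=X_k+\gamma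 b(X_k)+\sqrt\gamma Z_{k+1}$, where $(Z_k)_{k\ge1}$ are i.i.d. standard Gaussian vectors. Let $\Delta=\{(x,x):x\in\mathbb R^d\}$ and $\mathbf c(x,y)=\mathbb 1_{\Delta^c}(x,y)\,(1+\|x-y\|/R)$, where for $R=0$ the quotient is $+\infty$ when $x\ne y$ and $\mathbf c=0$ on $\Delta$. For probability measures $\mu,\nu$ on $\mathbb R^d$ and a cost $\mathbf a$ with values in $[0,\infty]$, let $\mathbf W_{\mathbf a}(\mu,\nu)=\inf_\zeta\int \mathbf a\,d\zeta$ over all couplings $\zeta$ of $\mu$ and $\nu$, let $\mathbf W_p=\mathbf W_{\mathbf a}^{1/p}$ with $\mathbf a(x,y)=\|x-y\|^p$, and let $\|\mu-\nu\|_{\mathrm{TV}}=\frac12\sup\{|\int f\,d\mu-\int f\,d\nu| : f \text{ measurable},\ |f|\le1\}$. Then for all $\gamma\in(0,\bar\gamma]$, $x,y\in\mathbb R^d$ and $k\in\mathbb N$ one has $$\mathbf W_{\mathbf c}(\delta_x\mathrm R_\gamma^k,\delta_y\mathrm R_\gamma^k)\le\lambda_{\bar\gamma}^{k\gamma/4}\big[D_{\bar\gamma,1}\mathbf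 c(x,y)+D_{\bar\gamma,2}\mathbb 1_{\Delta^c}(x,y)\big]+E_{\bar\gamma}\,\rho_{\bar\gamma}^{k\gamma/4}\mathbb 1_{\Delta^c}(x,y),$$ and, with the same rate $\rho_{\bar\gamma}$, $$\|\delta_x\mathrm R_\gamma^k-\delta_y\mathrm R_\gamma^k\|_{\mathrm{TV}}\le\mathbf W_{\mathbf c}(\delta_x\mathrm R_\gamma^k,\delta_y\mathrm R_\gamma^k)\le E_{\bar\gamma,1}\,\rho_{\bar\gamma}^{k\gamma/4}\,\mathbf c(x,y),$$ $$\mathbf W_1(\delta_x\mathrm R_\gamma^k,\delta_y\mathrm R_\gamma^k)\le E_{\bar\gamma,2}\,\rho_{\bar\gamma}^{k\gamma/4}\,\|x-y\|,$$ and, for every integer $p\ge1$ and every $\alpha\in(p,+\infty)$, $$\mathbf W_p(\delta_x\mathrm R_\gamma^k,\delta_y\mathrm R_\gamma^k)\le E_{\bar\gamma,\alpha}\,\rho_{\bar\gamma}^{k\gamma/(4\alpha)}\big(\|x-y\|+\|x-y\|^{1/\alpha}\big).$$ -/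

import Mathlib

open MeasureTheory ProbabilityTheory
open scoped ENNReal RealInnerProductSpace

/-- A map satisfying a Lipschitz inequality is measurable. -/
theorem measurable_of_norm_sub_le {E : Type*} [NormedAddCommGroup E] [MeasurableSpace E]
    [BorelSpace E] {b : E → E} {L : ℝ} (h : ∀ x y, ‖b x - b y‖ ≤ L * ‖x - y‖) :
    Measurable b := by
  have hb : LipschitzWith L.toNNReal b := LipschitzWith.of_dist_le_mul fun x y => by
    rw [dist_eq_norm, dist_eq_norm]
    exact (h x y).trans (mul_le_mul_of_nonneg_right (Real.le_coe_toNNReal L) (norm_nonneg _))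
  exact hb.continuous.measurable

/-- The Markov kernel of the recursion `X (k+1) = X k + γ b(X k) + √γ Z (k+1)`, with `Z` i.i.d.
standard Gaussian: from `x`, the law of `x + γ b(x) + √γ Z` with `Z ∼ N(0, Id)`. -/
noncomputable def eulerMaruyama {E : Type*} [NormedAddCommGroup E] [InnerProductSpace ℝ E]
    [FiniteDimensional ℝ E] [MeasurableSpace E] [BorelSpace E]
    (γ : ℝ) (b : E → E) (hb : Measurable b) : Kernel E E where
  toFun x := (stdGaussian E).map (fun z => x + γ • b x + √γ • z)
  measurable' := by
    have h : Measurable fun q : E × E => q.1 + γ • b q.1 + √γ • q.2 :=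
      (measurable_fst.add ((hb.comp measurable_fst).const_smul γ)).add
        (measurable_snd.const_smul (√γ))
    refine Measure.measurable_of_measurable_coe _ fun s hs => ?_
    have he : (fun x : E => ((stdGaussian E).map (fun z => x + γ • b x + √γ • z)) s)
        = fun x => stdGaussian E (Prod.mk x ⁻¹' ((fun q : E × E =>
            q.1 + γ • b q.1 + √γ • q.2) ⁻¹' s)) := by
      funext x
      exact Measure.map_apply (h.comp measurable_prodMk_left) hs
    rw [he]
    exact measurable_measure_prodMk_left (h hs)

/-- The law `δ_x R^k` of the `k`-th iterate of the Euler-Maruyama chain started at `x`, where the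
power is the one of the composition monoid of kernels. -/
noncomputable def eulerMaruyamaLaw {E : Type*} [NormedAddCommGroup E] [InnerProductSpace ℝ E]
    [FiniteDimensional ℝ E] [MeasurableSpace E] [BorelSpace E]
    (γ : ℝ) (b : E → E) (hb : Measurable b) (k : ℕ) (x : E) : Measure E :=
  (eulerMaruyama γ b hb ^ k) x

/-- The total variation norm of `μ - ν` (for finite measures), normalised by the factor `1/2`:
half of the supremum of `|∫ f dμ - ∫ f dν|` over measurable `f` with `|f| ≤ 1`. -/
noncomputable def tvDist {E : Type*} [MeasurableSpace E] (μ ν : Measure E) : ℝ≥0∞ :=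
  (⨆ f : {f : E → ℝ // Measurable f ∧ ∀ x, |f x| ≤ 1},
    ENNReal.ofReal |∫ x, f.1 x ∂μ - ∫ x, f.1 x ∂ν|) / 2

/-- The transference plans between `μ` and `ν`: measures on the product with marginals `μ`, `ν`. -/
def transferencePlans {E : Type*} [MeasurableSpace E] (μ ν : Measure E) : Set (Measure (E × E)) :=
  {ζ | ζ.map Prod.fst = μ ∧ ζ.map Prod.snd = ν}

/-- The transport cost `W_c(μ, ν)`, for a cost `c` with values in `[0, ∞]`. -/
noncomputable def wassersteinCost {E : Type*} [MeasurableSpace E] (c : E → E → ℝ≥0∞)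
    (μ ν : Measure E) : ℝ≥0∞ :=
  ⨅ ζ ∈ transferencePlans μ ν, ∫⁻ q, c q.1 q.2 ∂ζ

/-- The Wasserstein distance of order `p ≥ 1`, `W_p = (W_c)^(1/p)` with `c(x, y) = ‖x - y‖ ^ p`. -/
noncomputable def wassersteinDist {E : Type*} [NormedAddCommGroup E] [MeasurableSpace E] (p : ℕ)
    (μ ν : Measure E) : ℝ≥0∞ :=
  wassersteinCost (fun x y => ENNReal.ofReal (‖x - y‖ ^ p)) μ ν ^ (1 / (p : ℝ))

open Classical in
/-- The function `1_{Δᶜ}(x, y)`, where `Δ` is the diagonal. -/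
noncomputable def offDiag {E : Type*} (x y : E) : ℝ≥0∞ := if x = y then 0 else 1

/-- The cost `c(x, y) = 1_{Δᶜ}(x, y) (1 + ‖x - y‖ / R)`. The quotient is taken in `[0, ∞]`, so for
`R = 0` the cost is `∞` off the diagonal (and `0` on it, in every case). -/
noncomputable def mixedCost {E : Type*} [NormedAddCommGroup E] (R : ℝ) (x y : E) : ℝ≥0∞ :=
  offDiag x y * (1 + ENNReal.ofReal ‖x - y‖ / ENNReal.ofReal R)

/-!
The two chains are run under the maximal reflection coupling of their Gaussian increments. After
the drift step the chains stand at `u` and `v`; the increments agree on the orthogonal complement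
of `u - v`, while the components `g, g'` along `u - v` either make the chains meet or are
opposite. The distance of the two chains is then a one-dimensional quantity, which makes every
constant independent of the dimension. Two facts about the coupling carry the proof.

* Its marginals are correct: `map_fst_couplingMeasure` and `map_snd_couplingMeasure`.
* For an *odd* function `f`, the new distance `r'` satisfies `E f(r') = E f(‖u - v‖ + 2 √γ G)`
  with `G` a standard Gaussian variable (`lintegral_couplingMeasure_odd`): the coalescing part of
  the law of `‖u - v‖ + 2 √γ G` is symmetric about `0`, so an odd function does not see it.

Everything follows by inserting odd functions. With `H s = E sign(s + G)` (`signMean`), the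
functions `s ↦ H (s / τ)` are mapped to each other: `E H((u + σ G) / τ) = H(u / √(τ² + σ²))`, and
`sign` is the limiting case `τ = 0`.

* `f s = A H(s / τ) + s` is concave on the half-line and comparable to `s`. For `τ` small the
  widening of `τ` beats the expansion `1 + γ L` of the drift step; for `A` large the resulting
  gain beats the growth of the linear term on the bounded range where the drift does not contract,
  and beyond it the linear term contracts by itself. Hence `E f(r') ≤ (1 - c γ) f(r)`
  (`exists_concave_contraction`), which gives exponential decay of the mean distance.
* `f = sign` bounds the probability that the chains have not met: after about `1 / γ` steps it is
  at most a constant times the initial distance (`lintegral_offDiag_coupledChain_unit_time_le`).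
  Together with the decay of the mean distance this yields the bound for the mixed cost.
* `f s = s ^ N` with `N` odd bounds the moments of the distance uniformly in the number of steps
  (`lintegral_pow_norm_sub_coupledChain_pow_le`). Hölder's inequality between the first moment,
  which decays, and a high moment, which stays bounded, gives the decay of the Wasserstein
  distance of order `p`, at the cost of the exponent `1 / α` with `α > p`.

For `R = 0` the mixed cost is infinite off the diagonal. The estimates on the distances always use
the positive radius `R + 1`, beyond which the strong dissipativity holds as well.
-/

/-! ### The one-dimensional reflection coupling of Gaussians -/

/-- The probability with which the reflection coupling lets the chains coalesce when their
distance, in units of the noise, is `w` and the first Gaussian component is `g`: the minimum of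
`1` and the ratio of the standard Gaussian densities at `g + w` and at `g`. -/
noncomputable def acceptProb (w g : ℝ) : ℝ := min 1 (Real.exp (-(w * g) - w ^ 2 / 2))

theorem acceptProb_nonneg (w g : ℝ) : 0 ≤ acceptProb w g :=
  le_min zero_le_one (Real.exp_nonneg _)

theorem acceptProb_le_one (w g : ℝ) : acceptProb w g ≤ 1 := min_le_left _ _

/-- If the reflected positions would have changed their order, then the chains coalesce. -/
theorem acceptProb_eq_one {w g : ℝ} (hw : 0 ≤ w) (hg : w + 2 * g ≤ 0) : acceptProb w g = 1 := by
  refine min_eq_left (Real.one_le_exp ?_)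
  nlinarith

theorem measurable_acceptProb : Measurable fun q : ℝ × ℝ => acceptProb q.1 q.2 := by
  unfold acceptProb; fun_prop

theorem gaussianPDFReal_mul_acceptProb (w g : ℝ) :
    gaussianPDFReal 0 1 g * acceptProb w g
      = min (gaussianPDFReal 0 1 g) (gaussianPDFReal 0 1 (g + w)) := by
  rw [acceptProb, mul_min_of_nonneg _ _ (gaussianPDFReal_nonneg _ _ _), mul_one]
  congr 1
  simp only [gaussianPDFReal, mul_assoc, ← Real.exp_add]
  congr 2
  simp only [NNReal.coe_one]
  ring

theorem gaussianPDFReal_zero_neg (g : ℝ) :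
    gaussianPDFReal 0 1 (-g) = gaussianPDFReal 0 1 g := by
  simp [gaussianPDFReal]

theorem lintegral_gaussianReal_eq {h : ℝ → ℝ≥0∞} (hh : Measurable h) :
    ∫⁻ g, h g ∂(gaussianReal 0 1) = ∫⁻ g, ENNReal.ofReal (gaussianPDFReal 0 1 g) * h g := by
  rw [gaussianReal_of_var_ne_zero _ one_ne_zero,
    lintegral_withDensity_eq_lintegral_mul _ (measurable_gaussianPDF _ _) hh]
  rfl

/-- The second component of the coupled pair, `g + w` with probability `acceptProb w g` and `-g`
otherwise, is again a standard Gaussian variable. The density of the accepted part is the minimum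
of two translates, and the reflection carries the remaining mass to where it is missing. -/
theorem lintegral_gaussianReal_coupled (w : ℝ) {h : ℝ → ℝ≥0∞} (hh : Measurable h) :
    ∫⁻ g, (ENNReal.ofReal (acceptProb w g) * h (g + w)
        + ENNReal.ofReal (1 - acceptProb w g) * h (-g)) ∂(gaussianReal 0 1)
      = ∫⁻ g, h g ∂(gaussianReal 0 1) := by
  have ma : Measurable (acceptProb w) := measurable_acceptProb.comp measurable_prodMk_left
  have mp : Measurable (gaussianPDFReal 0 1) := measurable_gaussianPDFReal 0 1
  rw [lintegral_gaussianReal_eq (by fun_prop), lintegral_gaussianReal_eq hh]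
  have h1 : ∀ g, ENNReal.ofReal (gaussianPDFReal 0 1 g) *
      (ENNReal.ofReal (acceptProb w g) * h (g + w)
        + ENNReal.ofReal (1 - acceptProb w g) * h (-g))
      = ENNReal.ofReal (min (gaussianPDFReal 0 1 g) (gaussianPDFReal 0 1 (g + w))) * h (g + w)
        + ENNReal.ofReal (gaussianPDFReal 0 1 g
          - min (gaussianPDFReal 0 1 g) (gaussianPDFReal 0 1 (g + w))) * h (-g) := by
    intro g
    have := gaussianPDFReal_nonneg 0 1 g
    rw [mul_add, ← mul_assoc, ← mul_assoc, ← ENNReal.ofReal_mul this, ← ENNReal.ofReal_mul this,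
      mul_sub, mul_one, gaussianPDFReal_mul_acceptProb]
  simp only [h1]
  rw [lintegral_add_left (by fun_prop)]
  have h2 := lintegral_add_right_eq_self (μ := (volume : Measure ℝ)) (fun g =>
    ENNReal.ofReal (min (gaussianPDFReal 0 1 (g - w)) (gaussianPDFReal 0 1 g)) * h g) w
  have h3 := lintegral_neg_eq_self (fun g => ENNReal.ofReal (gaussianPDFReal 0 1 g
          - min (gaussianPDFReal 0 1 g) (gaussianPDFReal 0 1 (g + w))) * h (-g))
    (μ := (volume : Measure ℝ))
  simp only [add_sub_cancel_right] at h2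
  rw [h2, ← h3, ← lintegral_add_left (by fun_prop)]
  refine lintegral_congr fun g => ?_
  have h4 : gaussianPDFReal 0 1 (-g + w) = gaussianPDFReal 0 1 (g - w) := by
    rw [← gaussianPDFReal_zero_neg]; congr 1; ring
  rw [h4, gaussianPDFReal_zero_neg, neg_neg, ← add_mul, ← ENNReal.ofReal_add, min_comm]
  · congr 2; ring
  · exact le_min (gaussianPDFReal_nonneg _ _ _) (gaussianPDFReal_nonneg _ _ _)
  · exact sub_nonneg.2 (min_le_left _ _)

/-- The accepted part of the law of `w + 2 g` is symmetric about `0`, as `g ↦ -w - g` exchanges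
the two densities in the minimum. No integrability is needed: the integral is its own negative. -/
theorem integral_acceptProb_mul_odd (w : ℝ) {f : ℝ → ℝ} (hodd : ∀ s, f (-s) = -f s) :
    ∫ g, acceptProb w g * f (w + 2 * g) ∂(gaussianReal 0 1) = 0 := by
  rw [integral_gaussianReal_eq_integral_smul one_ne_zero]
  simp only [smul_eq_mul, ← mul_assoc, gaussianPDFReal_mul_acceptProb]
  have h := integral_sub_left_eq_self (μ := (volume : Measure ℝ))
    (fun g => min (gaussianPDFReal 0 1 g) (gaussianPDFReal 0 1 (g + w)) * f (w + 2 * g)) (-w)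
  have h1 : ∀ g, min (gaussianPDFReal 0 1 (-w - g)) (gaussianPDFReal 0 1 (-w - g + w))
      * f (w + 2 * (-w - g))
      = -(min (gaussianPDFReal 0 1 g) (gaussianPDFReal 0 1 (g + w)) * f (w + 2 * g)) := by
    intro g
    rw [← gaussianPDFReal_zero_neg (-w - g), ← gaussianPDFReal_zero_neg (-w - g + w), min_comm,
      show w + 2 * (-w - g) = -(w + 2 * g) by ring, hodd, show -(-w - g) = g + w by ring,
      show -(-w - g + w) = g by ring]
    ring
  simp only [h1, integral_neg] at h
  linarith

/-- For an odd `f`, the reflected part of the coupling carries the whole integral of `f (w + 2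
g)`. -/
theorem lintegral_reflected_odd {w : ℝ} (hw : 0 ≤ w) {f : ℝ → ℝ}
    (hodd : ∀ s, f (-s) = -f s)
    (hpos : ∀ s, 0 ≤ s → 0 ≤ f s)
    (hint : Integrable (fun g => f (w + 2 * g)) (gaussianReal 0 1)) :
    ∫⁻ g, ENNReal.ofReal (1 - acceptProb w g) * ENNReal.ofReal (f |w + 2 * g|) ∂(gaussianReal 0 1)
      = ENNReal.ofReal (∫ g, f (w + 2 * g) ∂(gaussianReal 0 1)) := by
  have ma : Measurable (acceptProb w) := measurable_acceptProb.comp measurable_prodMk_left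
  have h1 : ∀ g, ENNReal.ofReal (1 - acceptProb w g) * ENNReal.ofReal (f |w + 2 * g|)
      = ENNReal.ofReal ((1 - acceptProb w g) * f (w + 2 * g)) := by
    intro g
    rw [← ENNReal.ofReal_mul (sub_nonneg.2 (acceptProb_le_one _ _))]
    rcases le_total (w + 2 * g) 0 with h | h
    · rw [acceptProb_eq_one hw h]; simp
    · rw [abs_of_nonneg h]
  have hint2 : Integrable (fun g => acceptProb w g * f (w + 2 * g)) (gaussianReal 0 1) := by
    refine hint.bdd_mul (c := 1) ma.aestronglyMeasurable (ae_of_all _ fun g => ?_)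
    rw [Real.norm_eq_abs, abs_of_nonneg (acceptProb_nonneg _ _)]
    exact acceptProb_le_one _ _
  have h2 : ∀ g, (1 - acceptProb w g) * f (w + 2 * g)
      = f (w + 2 * g) - acceptProb w g * f (w + 2 * g) := fun g => by ring
  simp only [h1]
  rw [← ofReal_integral_eq_lintegral_ofReal]
  · simp only [h2]
    rw [integral_sub hint hint2, integral_acceptProb_mul_odd w hodd, sub_zero]
  · simp only [h2]; exact hint.sub hint2
  · refine ae_of_all _ fun g => ?_
    rcases le_total (w + 2 * g) 0 with h | h
    · simp [acceptProb_eq_one hw h]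
    · exact mul_nonneg (sub_nonneg.2 (acceptProb_le_one _ _)) (hpos _ h)

/-! ### The mean of the sign of a shifted Gaussian -/

@[fun_prop]
theorem measurable_realSign : Measurable Real.sign := by
  unfold Real.sign
  exact Measurable.ite measurableSet_Iio measurable_const
    (Measurable.ite measurableSet_Ioi measurable_const measurable_const)

theorem monotone_realSign : Monotone Real.sign := by
  intro a b hab
  unfold Real.sign
  split_ifs <;> linarith

theorem abs_realSign_le_one (s : ℝ) : |Real.sign s| ≤ 1 := by
  unfold Real.sign
  split_ifs <;> simp

/-- The mean of `sign (s + G)` for a standard Gaussian variable `G`; for `s ≥ 0` this is also the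
probability of `|G| < s`. -/
noncomputable def signMean (s : ℝ) : ℝ := ∫ g, Real.sign (s + g) ∂(gaussianReal 0 1)

theorem integrable_realSign_comp {Ω : Type*} [MeasurableSpace Ω] {μ : Measure Ω}
    [IsFiniteMeasure μ] {X : Ω → ℝ} (hX : Measurable X) :
    Integrable (fun ω => Real.sign (X ω)) μ :=
  Integrable.of_bound (measurable_realSign.comp hX).aestronglyMeasurable 1
    (ae_of_all _ fun _ => abs_realSign_le_one _)

theorem integral_gaussianReal_neg (f : ℝ → ℝ) :
    ∫ g, f (-g) ∂(gaussianReal 0 1) = ∫ g, f g ∂(gaussianReal 0 1) := by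
  have h : (gaussianReal 0 1).map (fun x => -x) = gaussianReal 0 1 := by
    rw [gaussianReal_map_neg, neg_zero]
  conv_rhs => rw [← h]
  exact ((MeasurableEquiv.neg ℝ).measurableEmbedding.integral_map f).symm

theorem signMean_neg (s : ℝ) : signMean (-s) = -signMean s := by
  unfold signMean
  rw [← integral_gaussianReal_neg, ← integral_neg]
  refine integral_congr_ae (ae_of_all _ fun g => ?_)
  change Real.sign (-s + -g) = -Real.sign (s + g)
  rw [← Real.sign_neg]
  congr 1
  ring

theorem signMean_zero : signMean 0 = 0 := by
  have := signMean_neg 0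
  rw [neg_zero] at this
  linarith

theorem monotone_signMean : Monotone signMean := fun s t hst =>
  integral_mono (integrable_realSign_comp (by fun_prop)) (integrable_realSign_comp (by fun_prop))
    fun g => monotone_realSign (by linarith)

theorem signMean_nonneg {s : ℝ} (hs : 0 ≤ s) : 0 ≤ signMean s :=
  signMean_zero.symm.trans_le (monotone_signMean hs)

theorem abs_signMean_le_one (s : ℝ) : |signMean s| ≤ 1 := by
  have := norm_integral_le_of_norm_le_const (μ := gaussianReal 0 1)
    (f := fun g => Real.sign (s + g)) (C := 1) (ae_of_all _ fun _ => abs_realSign_le_one _)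
  simpa [signMean] using this

theorem integral_sign_add_mul {σ : ℝ} (hσ : 0 < σ) (u : ℝ) :
    ∫ g, Real.sign (u + σ * g) ∂(gaussianReal 0 1) = signMean (u / σ) := by
  refine integral_congr_ae (ae_of_all _ fun g => ?_)
  have h : u + σ * g = σ * (u / σ + g) := by field_simp
  change Real.sign (u + σ * g) = Real.sign (u / σ + g)
  rw [h]
  unfold Real.sign
  simp [mul_neg_iff, hσ, hσ.not_gt]

/-- Stability of the family `s ↦ signMean (s / τ)` under Gaussian perturbation: the independent
Gaussians of deviations `τ` and `σ` add up to one of deviation `√(τ ^ 2 + σ ^ 2)`. -/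
theorem integral_signMean_add_mul {σ τ : ℝ} (hσ : 0 < σ) (hτ : 0 < τ) (u : ℝ) :
    ∫ g, signMean ((u + σ * g) / τ) ∂(gaussianReal 0 1) = signMean (u / √(τ ^ 2 + σ ^ 2)) := by
  have hpos : 0 < τ ^ 2 + σ ^ 2 := by positivity
  have hsq : 0 < √(τ ^ 2 + σ ^ 2) := Real.sqrt_pos.2 hpos
  simp only [← integral_sign_add_mul hτ, ← integral_sign_add_mul hsq]
  have hm : ∀ c : ℝ, (gaussianReal 0 1).map (fun x => c * x)
      = gaussianReal 0 (.mk (c ^ 2) (sq_nonneg c)) := fun c => by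
    rw [gaussianReal_map_const_mul, mul_zero, mul_one]
  have hprob : ∀ c : ℝ, IsProbabilityMeasure ((gaussianReal 0 1).map (fun x => c * x)) :=
    fun c => by rw [hm]; infer_instance
  have hconv : (gaussianReal 0 1).map (fun x => σ * x) ∗ (gaussianReal 0 1).map (fun x => τ * x)
      = (gaussianReal 0 1).map (fun x => √(τ ^ 2 + σ ^ 2) * x) := by
    rw [hm, hm, hm, gaussianReal_conv_gaussianReal, add_zero]
    congr 1
    ext
    change σ ^ 2 + τ ^ 2 = √(τ ^ 2 + σ ^ 2) ^ 2
    rw [Real.sq_sqrt hpos.le, add_comm]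
  have hmap : ∀ a c : ℝ, ∫ g, Real.sign (a + c * g) ∂(gaussianReal 0 1)
      = ∫ z, Real.sign (a + z) ∂((gaussianReal 0 1).map (fun x => c * x)) := fun a c =>
    (integral_map (f := fun z => Real.sign (a + z)) (by fun_prop)
      (Measurable.aestronglyMeasurable (by fun_prop))).symm
  rw [hmap u, ← hconv, integral_conv (integrable_realSign_comp (by fun_prop)),
    integral_map (f := fun x => ∫ y, Real.sign (u + (x + y))
      ∂((gaussianReal 0 1).map (fun x => τ * x))) (by fun_prop)]
  · refine integral_congr_ae (ae_of_all _ fun g => ?_)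
    simpa only [add_assoc] using hmap (u + σ * g) τ
  · refine StronglyMeasurable.aestronglyMeasurable ?_
    refine StronglyMeasurable.integral_prod_right
      (f := fun x y : ℝ => Real.sign (u + (x + y))) ?_
    exact Measurable.stronglyMeasurable (by fun_prop)

theorem gaussianReal_real_eq_setIntegral (s : Set ℝ) :
    (gaussianReal 0 1).real s = ∫ x in s, gaussianPDFReal 0 1 x := by
  rw [measureReal_def, gaussianReal_apply_eq_integral _ one_ne_zero, ENNReal.toReal_ofReal]
  exact integral_nonneg fun x => gaussianPDFReal_nonneg _ _ _

theorem gaussianPDFReal_le_half (x : ℝ) : gaussianPDFReal 0 1 x ≤ 1 / 2 := by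
  have h2 : (2 : ℝ) ≤ √(2 * Real.pi * 1) := by
    refine Real.le_sqrt_of_sq_le ?_
    nlinarith [Real.pi_gt_three]
  have h3 : Real.exp (-(x - 0) ^ 2 / (2 * 1)) ≤ 1 := by
    rw [Real.exp_le_one_iff]; nlinarith [sq_nonneg (x - 0)]
  unfold gaussianPDFReal
  simp only [NNReal.coe_one]
  calc (√(2 * Real.pi * 1))⁻¹ * Real.exp (-(x - 0) ^ 2 / (2 * 1)) ≤ 2⁻¹ * 1 := by gcongr
    _ = 1 / 2 := by norm_num

theorem signMean_sub_le {s t : ℝ} (h : t ≤ s) : signMean s - signMean t ≤ s - t := by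
  unfold signMean
  rw [← integral_sub (integrable_realSign_comp (by fun_prop))
    (integrable_realSign_comp (by fun_prop))]
  have hle : ∀ g, Real.sign (s + g) - Real.sign (t + g)
      ≤ (Set.Icc (-s) (-t)).indicator (fun _ => (2 : ℝ)) g := by
    intro g
    by_cases hg : g ∈ Set.Icc (-s) (-t)
    · rw [Set.indicator_of_mem hg]
      have h1 := abs_le.1 (abs_realSign_le_one (s + g))
      have h2 := abs_le.1 (abs_realSign_le_one (t + g))
      linarith
    · rw [Set.indicator_of_notMem hg]
      rw [Set.mem_Icc, not_and_or, not_le, not_le] at hg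
      unfold Real.sign
      split_ifs <;> rcases hg with hg | hg <;> linarith
  calc _ ≤ ∫ g, (Set.Icc (-s) (-t)).indicator (fun _ => (2 : ℝ)) g ∂(gaussianReal 0 1) :=
        integral_mono ((integrable_realSign_comp (by fun_prop)).sub
          (integrable_realSign_comp (by fun_prop)))
          ((integrable_const _).indicator measurableSet_Icc) hle
    _ = 2 * (gaussianReal 0 1).real (Set.Icc (-s) (-t)) := by
        rw [integral_indicator_const _ measurableSet_Icc, smul_eq_mul, mul_comm]
    _ ≤ 2 * (1 / 2 * (s - t)) := by
        rw [gaussianReal_real_eq_setIntegral]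
        have : ∫ x in Set.Icc (-s) (-t), gaussianPDFReal 0 1 x
            ≤ ∫ x in Set.Icc (-s) (-t), (1 / 2 : ℝ) :=
          setIntegral_mono (integrable_gaussianPDFReal 0 1).integrableOn
            (integrableOn_const (by simp)) gaussianPDFReal_le_half
        rw [setIntegral_const, Real.volume_real_Icc_of_le (by linarith), smul_eq_mul] at this
        linarith
    _ = s - t := by ring

/-- A lower bound on the increments of `signMean` below `S`, from the density being decreasing. -/
theorem le_signMean_sub {s t S : ℝ} (ht : 0 ≤ t) (h : t ≤ s) (hS : s ≤ S) :
    2 * gaussianPDFReal 0 1 S * (s - t) ≤ signMean s - signMean t := by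
  unfold signMean
  rw [← integral_sub (integrable_realSign_comp (by fun_prop))
    (integrable_realSign_comp (by fun_prop))]
  have hle : ∀ g, (Set.Ioo (-s) (-t)).indicator (fun _ => (2 : ℝ)) g
      ≤ Real.sign (s + g) - Real.sign (t + g) := by
    intro g
    by_cases hg : g ∈ Set.Ioo (-s) (-t)
    · rw [Set.indicator_of_mem hg, Real.sign_of_pos (by linarith [hg.1]),
        Real.sign_of_neg (by linarith [hg.2])]
      norm_num
    · rw [Set.indicator_of_notMem hg]
      exact sub_nonneg.2 (monotone_realSign (by linarith))
  refine le_trans ?_ (integral_mono ((integrable_const _).indicator measurableSet_Ioo)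
    ((integrable_realSign_comp (by fun_prop)).sub (integrable_realSign_comp (by fun_prop))) hle)
  rw [integral_indicator_const _ measurableSet_Ioo, smul_eq_mul, gaussianReal_real_eq_setIntegral]
  have : ∫ x in Set.Ioo (-s) (-t), gaussianPDFReal 0 1 S
      ≤ ∫ x in Set.Ioo (-s) (-t), gaussianPDFReal 0 1 x := by
    refine setIntegral_mono_on (integrableOn_const (by simp))
      (integrable_gaussianPDFReal 0 1).integrableOn measurableSet_Ioo fun x hx => ?_
    unfold gaussianPDFReal
    have : (x - 0) ^ 2 ≤ (S - 0) ^ 2 := by nlinarith [hx.1, hx.2]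
    gcongr
  rw [setIntegral_const, Real.volume_real_Ioo_of_le (by linarith), smul_eq_mul] at this
  linarith

/-! ### The reflection coupling in a Euclidean space -/

section Coupling

variable {E : Type*} [NormedAddCommGroup E] [InnerProductSpace ℝ E]

/-- The vector `z` with its component along `e` replaced by `g`, for a unit vector `e`. For `e =
0` it is `z` itself. -/
def replaceComponent (e z : E) (g : ℝ) : E := z - ⟪e, z⟫ • e + g • e

theorem inner_replaceComponent (e z t : E) (g : ℝ) :
    ⟪replaceComponent e z g, t⟫ = ⟪z, t - ⟪e, t⟫ • e⟫ + g * ⟪e, t⟫ := by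
  simp only [replaceComponent, inner_add_left, inner_sub_left, inner_sub_right,
    real_inner_smul_left, real_inner_smul_right, real_inner_comm e z]
  ring

/-- The unit vector pointing from `v` to `u`, and `0` if `u = v`. -/
noncomputable def unitDir (u v : E) : E := ‖u - v‖⁻¹ • (u - v)

theorem norm_unitDir {u v : E} (h : u ≠ v) : ‖unitDir u v‖ = 1 := by
  rw [unitDir, norm_smul, norm_inv, norm_norm, inv_mul_cancel₀ (norm_sub_eq_zero_iff.not.2 h)]

theorem norm_smul_unitDir (u v : E) : ‖u - v‖ • unitDir u v = u - v := by
  rcases eq_or_ne u v with rfl | h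
  · simp
  · rw [unitDir, smul_inv_smul₀ (norm_sub_eq_zero_iff.not.2 h)]

theorem unitDir_self (u : E) : unitDir u u = 0 := by simp [unitDir]

variable [MeasurableSpace E] [BorelSpace E] [FiniteDimensional ℝ E]

/-- Replacing the component of a standard Gaussian vector along `e` by an independent standard
Gaussian variable gives a standard Gaussian vector. -/
theorem map_replaceComponent {e : E} (he : e = 0 ∨ ‖e‖ = 1) :
    ((stdGaussian E).prod (gaussianReal 0 1)).map (fun q => replaceComponent e q.1 q.2)
      = stdGaussian E := by
  have hm : Measurable fun q : E × ℝ => replaceComponent e q.1 q.2 := by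
    unfold replaceComponent; fun_prop
  have := Measure.isProbabilityMeasure_map
    (μ := (stdGaussian E).prod (gaussianReal 0 1)) hm.aemeasurable
  refine Measure.ext_of_charFun (funext fun t => ?_)
  rw [charFun_apply, integral_map hm.aemeasurable (by fun_prop)]
  have h1 : ∀ q : E × ℝ, Complex.exp (⟪replaceComponent e q.1 q.2, t⟫ * Complex.I)
      = Complex.exp (⟪q.1, t - ⟪e, t⟫ • e⟫ * Complex.I)
        * Complex.exp ((⟪e, t⟫ : ℝ) * q.2 * Complex.I) := by
    intro q
    rw [inner_replaceComponent, ← Complex.exp_add]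
    congr 1
    push_cast
    ring
  simp only [h1]
  rw [integral_prod_mul (fun z : E => Complex.exp (⟪z, t - ⟪e, t⟫ • e⟫ * Complex.I))
    (fun g : ℝ => Complex.exp ((⟪e, t⟫ : ℝ) * g * Complex.I)), ← charFun_apply,
    ← charFun_apply_real, charFun_stdGaussian, charFun_stdGaussian, charFun_gaussianReal,
    ← Complex.exp_add]
  congr 1
  have h2 : ‖t - ⟪e, t⟫ • e‖ ^ 2 + ⟪e, t⟫ ^ 2 = ‖t‖ ^ 2 := by
    rw [norm_sub_sq_real, norm_smul, real_inner_smul_right, real_inner_comm, mul_pow,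
      Real.norm_eq_abs, sq_abs]
    rcases he with rfl | he
    · simp
    · rw [he]; ring
  rw [← Complex.ofReal_pow ‖t‖, ← h2]
  push_cast
  ring

/-- The pair of new positions, from `p` and the noise `q`, when the chains are to coalesce: the
second Gaussian component is shifted by the distance in units of `√γ`, so that both positions
agree. -/
noncomputable def acceptedPair (γ : ℝ) (p : E × E) (q : E × ℝ) : E × E :=
  (p.1 + √γ • replaceComponent (unitDir p.1 p.2) q.1 q.2,
    p.2 + √γ • replaceComponent (unitDir p.1 p.2) q.1 (q.2 + ‖p.1 - p.2‖ / √γ))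

/-- The pair of new positions, from `p` and the noise `q`, when the second chain uses the
reflected Gaussian component. -/
noncomputable def reflectedPair (γ : ℝ) (p : E × E) (q : E × ℝ) : E × E :=
  (p.1 + √γ • replaceComponent (unitDir p.1 p.2) q.1 q.2,
    p.2 + √γ • replaceComponent (unitDir p.1 p.2) q.1 (-q.2))

theorem measurable_acceptedPair (γ : ℝ) :
    Measurable fun r : (E × E) × (E × ℝ) => acceptedPair γ r.1 r.2 := by
  unfold acceptedPair replaceComponent unitDir
  fun_prop

theorem measurable_reflectedPair (γ : ℝ) :
    Measurable fun r : (E × E) × (E × ℝ) => reflectedPair γ r.1 r.2 := by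
  unfold reflectedPair replaceComponent unitDir
  fun_prop

/-- The maximal reflection coupling of the Gaussian measures of covariance `γ • Id` centred at
`p.1` and `p.2`. The random choice between the two pairs is encoded by the densities of two image
measures. -/
noncomputable def couplingMeasure (γ : ℝ) (p : E × E) : Measure (E × E) :=
  (((stdGaussian E).prod (gaussianReal 0 1)).withDensity fun q =>
      ENNReal.ofReal (acceptProb (‖p.1 - p.2‖ / √γ) q.2)).map (acceptedPair γ p)
  + (((stdGaussian E).prod (gaussianReal 0 1)).withDensity fun q =>
      ENNReal.ofReal (1 - acceptProb (‖p.1 - p.2‖ / √γ) q.2)).map (reflectedPair γ p)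

theorem lintegral_couplingMeasure (γ : ℝ) (p : E × E) {h : E × E → ℝ≥0∞} (hh : Measurable h) :
    ∫⁻ r, h r ∂(couplingMeasure γ p)
      = ∫⁻ q, (ENNReal.ofReal (acceptProb (‖p.1 - p.2‖ / √γ) q.2) * h (acceptedPair γ p q)
        + ENNReal.ofReal (1 - acceptProb (‖p.1 - p.2‖ / √γ) q.2) * h (reflectedPair γ p q))
          ∂((stdGaussian E).prod (gaussianReal 0 1)) := by
  have ma : Measurable (acceptProb (‖p.1 - p.2‖ / √γ)) :=
    measurable_acceptProb.comp measurable_prodMk_left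
  have m1 : Measurable (acceptedPair γ p) := (measurable_acceptedPair γ).comp measurable_prodMk_left
  have m2 : Measurable (reflectedPair γ p) :=
    (measurable_reflectedPair γ).comp measurable_prodMk_left
  rw [couplingMeasure, lintegral_add_measure, lintegral_map hh m1, lintegral_map hh m2,
    lintegral_withDensity_eq_lintegral_mul _ (by fun_prop)
      (show Measurable fun q => h (acceptedPair γ p q) from hh.comp m1),
    lintegral_withDensity_eq_lintegral_mul _ (by fun_prop)
      (show Measurable fun q => h (reflectedPair γ p q) from hh.comp m2), ← lintegral_add_left]
  · rfl
  · exact Measurable.mul (by fun_prop) (hh.comp m1)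

theorem map_fst_couplingMeasure (γ : ℝ) (p : E × E) :
    (couplingMeasure γ p).map Prod.fst = (stdGaussian E).map fun z => p.1 + √γ • z := by
  refine Measure.ext_of_lintegral _ fun h hh => ?_
  have hdir : unitDir p.1 p.2 = 0 ∨ ‖unitDir p.1 p.2‖ = 1 := by
    rcases eq_or_ne p.1 p.2 with h | h
    · left; rw [h, unitDir_self]
    · exact Or.inr (norm_unitDir h)
  rw [lintegral_map hh measurable_fst, lintegral_couplingMeasure _ _ (by fun_prop),
    lintegral_map hh (by fun_prop)]
  conv_rhs => rw [← map_replaceComponent hdir, lintegral_map (by fun_prop)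
      (by unfold replaceComponent; fun_prop)]
  refine lintegral_congr fun q => ?_
  rw [acceptedPair, reflectedPair, ← add_mul,
    ← ENNReal.ofReal_add (acceptProb_nonneg _ _) (sub_nonneg.2 (acceptProb_le_one _ _))]
  simp

theorem map_snd_couplingMeasure (γ : ℝ) (p : E × E) :
    (couplingMeasure γ p).map Prod.snd = (stdGaussian E).map fun z => p.2 + √γ • z := by
  refine Measure.ext_of_lintegral _ fun h hh => ?_
  have hdir : unitDir p.1 p.2 = 0 ∨ ‖unitDir p.1 p.2‖ = 1 := by
    rcases eq_or_ne p.1 p.2 with h | h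
    · left; rw [h, unitDir_self]
    · exact Or.inr (norm_unitDir h)
  have ma : Measurable (acceptProb (‖p.1 - p.2‖ / √γ)) :=
    measurable_acceptProb.comp measurable_prodMk_left
  have m1 : Measurable (acceptedPair γ p) := (measurable_acceptedPair γ).comp measurable_prodMk_left
  have m2 : Measurable (reflectedPair γ p) :=
    (measurable_reflectedPair γ).comp measurable_prodMk_left
  have mr : Measurable fun q : E × ℝ => replaceComponent (unitDir p.1 p.2) q.1 q.2 := by
    unfold replaceComponent; fun_prop
  rw [lintegral_map hh measurable_snd, lintegral_couplingMeasure _ _ (by fun_prop),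
    lintegral_map hh (by fun_prop), lintegral_prod _ (by fun_prop)]
  conv_rhs => rw [← map_replaceComponent hdir, lintegral_map (by fun_prop) mr,
    lintegral_prod _ (by fun_prop)]
  refine lintegral_congr fun z => ?_
  exact lintegral_gaussianReal_coupled (‖p.1 - p.2‖ / √γ)
    (h := fun g => h (p.2 + √γ • replaceComponent (unitDir p.1 p.2) z g))
    (hh.comp (((mr.comp measurable_prodMk_left).const_smul _).const_add _))

/-- The distance of the coupled positions, seen by an odd function, is a Gaussian perturbation of
variance `4 γ` of the distance of the centres. -/
theorem lintegral_couplingMeasure_odd {γ : ℝ} (hγ : 0 < γ) (p : E × E) {f : ℝ → ℝ}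
    (hf : Measurable f) (hodd : ∀ s, f (-s) = -f s) (hpos : ∀ s, 0 ≤ s → 0 ≤ f s)
    (hint : Integrable (fun g => f (‖p.1 - p.2‖ + 2 * √γ * g)) (gaussianReal 0 1)) :
    ∫⁻ r, ENNReal.ofReal (f ‖r.1 - r.2‖) ∂(couplingMeasure γ p)
      = ENNReal.ofReal (∫ g, f (‖p.1 - p.2‖ + 2 * √γ * g) ∂(gaussianReal 0 1)) := by
  have hs : 0 < √γ := Real.sqrt_pos.2 hγ
  have hf0 : f 0 = 0 := by have := hodd 0; rw [neg_zero] at this; linarith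
  have ha : ∀ q, (acceptedPair γ p q).1 - (acceptedPair γ p q).2 = 0 := fun q => by
    have h := norm_smul_unitDir p.1 p.2
    simp only [acceptedPair, replaceComponent]
    rw [add_smul q.2, smul_add, smul_add, smul_add, smul_smul _ (‖p.1 - p.2‖ / √γ),
      mul_div_cancel₀ _ hs.ne', h]
    abel
  have hr : ∀ q, ENNReal.ofReal (1 - acceptProb (‖p.1 - p.2‖ / √γ) q.2)
        * ENNReal.ofReal (f ‖(reflectedPair γ p q).1 - (reflectedPair γ p q).2‖)
      = ENNReal.ofReal (1 - acceptProb (‖p.1 - p.2‖ / √γ) q.2)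
        * ENNReal.ofReal (f (√γ * |‖p.1 - p.2‖ / √γ + 2 * q.2|)) := fun q => by
    rcases eq_or_ne p.1 p.2 with h | h
    · simp [h, acceptProb]
    · have h1 : (reflectedPair γ p q).1 - (reflectedPair γ p q).2
          = (√γ * (‖p.1 - p.2‖ / √γ + 2 * q.2)) • unitDir p.1 p.2 := by
        have h2 := norm_smul_unitDir p.1 p.2
        rw [mul_add, mul_div_cancel₀ _ hs.ne', add_smul, h2]
        simp only [reflectedPair, replaceComponent]
        module
      rw [h1, norm_smul, norm_unitDir h, mul_one, norm_mul, Real.norm_eq_abs, Real.norm_eq_abs,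
        abs_of_pos hs]
  have hscale : ∀ g : ℝ, √γ * (‖p.1 - p.2‖ / √γ + 2 * g) = ‖p.1 - p.2‖ + 2 * √γ * g := fun g => by
    field_simp
  rw [lintegral_couplingMeasure _ _ (by fun_prop)]
  simp only [ha, hr, norm_zero, hf0, ENNReal.ofReal_zero, mul_zero, zero_add]
  have h3 := lintegral_reflected_odd (w := ‖p.1 - p.2‖ / √γ) (by positivity)
    (f := fun s => f (√γ * s)) (fun s => by rw [mul_neg, hodd])
    (fun s hs' => hpos _ (by positivity)) (by simpa only [hscale] using hint)
  simp only [hscale] at h3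
  have ma : Measurable (acceptProb (‖p.1 - p.2‖ / √γ)) :=
    measurable_acceptProb.comp measurable_prodMk_left
  rw [← h3, lintegral_prod _ (by fun_prop)]
  simp

/-- The reflection coupling as a kernel in the pair of centres. -/
noncomputable def reflectionCoupling (γ : ℝ) : Kernel (E × E) (E × E) where
  toFun := couplingMeasure γ
  measurable' := by
    refine Measure.measurable_of_measurable_coe _ fun s hs => ?_
    have hind : Measurable (s.indicator (1 : E × E → ℝ≥0∞)) := measurable_one.indicator hs
    have he : (fun p : E × E => couplingMeasure γ p s)
        = fun p => ∫⁻ q, (ENNReal.ofReal (acceptProb (‖p.1 - p.2‖ / √γ) q.2)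
            * s.indicator 1 (acceptedPair γ p q)
          + ENNReal.ofReal (1 - acceptProb (‖p.1 - p.2‖ / √γ) q.2)
            * s.indicator 1 (reflectedPair γ p q)) ∂((stdGaussian E).prod (gaussianReal 0 1)) := by
      funext p
      rw [← lintegral_couplingMeasure γ p hind, lintegral_indicator_one hs]
    rw [he]
    have ma : Measurable fun r : (E × E) × (E × ℝ) =>
        acceptProb (‖r.1.1 - r.1.2‖ / √γ) r.2.2 :=
      measurable_acceptProb.comp (f := fun r : (E × E) × (E × ℝ) =>
        (‖r.1.1 - r.1.2‖ / √γ, r.2.2)) (by fun_prop)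
    have m1 := hind.comp (measurable_acceptedPair (E := E) γ)
    have m2 := hind.comp (measurable_reflectedPair (E := E) γ)
    exact Measurable.lintegral_prod_right' (f := fun r : (E × E) × (E × ℝ) =>
      ENNReal.ofReal (acceptProb (‖r.1.1 - r.1.2‖ / √γ) r.2.2)
            * s.indicator 1 (acceptedPair γ r.1 r.2)
          + ENNReal.ofReal (1 - acceptProb (‖r.1.1 - r.1.2‖ / √γ) r.2.2)
            * s.indicator 1 (reflectedPair γ r.1 r.2))
      (((ENNReal.measurable_ofReal.comp ma).mul m1).add
        ((ENNReal.measurable_ofReal.comp (measurable_const.sub ma)).mul m2))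

end Coupling

/-! ### Powers of kernels and the coupled chain -/

section KernelPowers

variable {α β : Type*} [MeasurableSpace α] [MeasurableSpace β]

theorem isMarkovKernel_pow (K : Kernel α α) [IsMarkovKernel K] (k : ℕ) :
    IsMarkovKernel (K ^ k) := by
  induction k with
  | zero => rw [pow_zero]; exact (inferInstance : IsMarkovKernel (Kernel.id : Kernel α α))
  | succ k ih => rw [pow_succ]; exact (inferInstance : IsMarkovKernel ((K ^ k) ∘ₖ K))

/-- If `φ` maps the steps of `K` to steps of `R`, then it maps the iterates of `K` to those of
`R`. -/
theorem map_pow_of_intertwining {K : Kernel α α} {R : Kernel β β} {φ : α → β} (hφ : Measurable φ)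
    (h : ∀ a, (K a).map φ = R (φ a)) (k : ℕ) (a : α) :
    ((K ^ k) a).map φ = (R ^ k) (φ a) := by
  induction k with
  | zero =>
    simp only [pow_zero]
    exact (congrArg (Measure.map φ) (Kernel.id_apply a)).trans
      ((Measure.map_dirac' hφ a).trans (Kernel.id_apply (φ a)).symm)
  | succ k ih =>
    ext s hs
    rw [Measure.map_apply hφ hs, Kernel.pow_succ_apply_eq_lintegral _ _ _ (hφ hs),
      Kernel.pow_succ_apply_eq_lintegral _ _ _ hs, ← ih,
      lintegral_map (Kernel.measurable_coe _ hs) hφ]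
    refine lintegral_congr fun c => ?_
    rw [← h, Measure.map_apply hφ hs]

theorem lintegral_pow_add (K : Kernel α α) (i j : ℕ) (a : α) {V : α → ℝ≥0∞} (hV : Measurable V) :
    ∫⁻ z, V z ∂((K ^ (i + j)) a) = ∫⁻ c, ∫⁻ z, V z ∂((K ^ i) c) ∂((K ^ j) a) := by
  rw [Kernel.pow_add, Kernel.lintegral_comp _ _ _ hV]

/-- Iteration of a drift condition `K V ≤ c V + d`; the constant `B` dominates the fixed point of
`t ↦ c t + d`. -/
theorem lintegral_pow_le_of_drift {K : Kernel α α} [IsMarkovKernel K] {V : α → ℝ≥0∞}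
    (hV : Measurable V) {c d B : ℝ≥0∞} (h : ∀ a, ∫⁻ z, V z ∂(K a) ≤ c * V a + d)
    (hB : c * B + d ≤ B) (k : ℕ) (a : α) :
    ∫⁻ z, V z ∂((K ^ k) a) ≤ c ^ k * V a + B := by
  induction k with
  | zero =>
    rw [pow_zero, pow_zero, one_mul]
    exact ((lintegral_dirac' a hV).le).trans le_self_add
  | succ k ih =>
    have := isMarkovKernel_pow K k
    calc ∫⁻ z, V z ∂((K ^ (k + 1)) a) = ∫⁻ q, ∫⁻ z, V z ∂(K q) ∂((K ^ k) a) := by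
          rw [add_comm, lintegral_pow_add K 1 k a hV, pow_one]
      _ ≤ ∫⁻ q, (c * V q + d) ∂((K ^ k) a) := lintegral_mono h
      _ = c * ∫⁻ q, V q ∂((K ^ k) a) + d := by
          rw [lintegral_add_right _ measurable_const, lintegral_const_mul _ hV]; simp
      _ ≤ c * (c ^ k * V a + B) + d := by gcongr
      _ = c ^ (k + 1) * V a + (c * B + d) := by ring
      _ ≤ c ^ (k + 1) * V a + B := by gcongr

end KernelPowers

section DriftStep

variable {E : Type*} [NormedAddCommGroup E] [InnerProductSpace ℝ E]

/-- The deterministic part of one step of the recursion. -/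
def driftStep (γ : ℝ) (b : E → E) (x : E) : E := x + γ • b x

theorem norm_driftStep_sub_le {b : E → E} {L : ℝ} (hLip : ∀ x y, ‖b x - b y‖ ≤ L * ‖x - y‖)
    {γ : ℝ} (hγ : 0 ≤ γ) (x y : E) :
    ‖driftStep γ b x - driftStep γ b y‖ ≤ (1 + γ * L) * ‖x - y‖ := by
  have h : driftStep γ b x - driftStep γ b y = (x - y) + γ • (b x - b y) := by
    unfold driftStep; module
  calc ‖driftStep γ b x - driftStep γ b y‖ ≤ ‖x - y‖ + ‖γ • (b x - b y)‖ := h ▸ norm_add_le _ _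
    _ ≤ ‖x - y‖ + γ * (L * ‖x - y‖) := by
        rw [norm_smul, Real.norm_of_nonneg hγ]; gcongr; exact hLip x y
    _ = _ := by ring

theorem norm_driftStep_sub_le_of_dissipative {b : E → E} {L mPlus : ℝ}
    (hLip : ∀ x y, ‖b x - b y‖ ≤ L * ‖x - y‖) {γ : ℝ} (hγ : 0 ≤ γ) (hγL : γ * L ^ 2 ≤ mPlus)
    (hγm : γ * mPlus ≤ 1) {x y : E} (h : ⟪b x - b y, x - y⟫ ≤ -mPlus * ‖x - y‖ ^ 2) :
    ‖driftStep γ b x - driftStep γ b y‖ ≤ (1 - γ * mPlus / 2) * ‖x - y‖ := by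
  have h1 : driftStep γ b x - driftStep γ b y = (x - y) + γ • (b x - b y) := by
    unfold driftStep; module
  have h2 : ‖b x - b y‖ ^ 2 ≤ (L * ‖x - y‖) ^ 2 := by
    gcongr; exact hLip x y
  refine le_of_sq_le_sq ?_ (mul_nonneg (by linarith) (norm_nonneg _))
  rw [h1, norm_add_sq_real, real_inner_smul_right, real_inner_comm, norm_smul,
    Real.norm_of_nonneg hγ]
  have h3 : γ * ⟪b x - b y, x - y⟫ ≤ γ * (-mPlus * ‖x - y‖ ^ 2) := by gcongr
  have h4 : (γ * ‖b x - b y‖) ^ 2 ≤ γ * (mPlus * ‖x - y‖ ^ 2) := by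
    calc (γ * ‖b x - b y‖) ^ 2 = γ * (γ * ‖b x - b y‖ ^ 2) := by ring
      _ ≤ γ * (γ * (L * ‖x - y‖) ^ 2) := by gcongr
      _ = γ * (γ * L ^ 2 * ‖x - y‖ ^ 2) := by ring
      _ ≤ γ * (mPlus * ‖x - y‖ ^ 2) := by gcongr
  nlinarith [sq_nonneg (γ * mPlus / 2 * ‖x - y‖)]

end DriftStep

section CoupledChain

variable {E : Type*} [NormedAddCommGroup E] [InnerProductSpace ℝ E] [FiniteDimensional ℝ E]
  [MeasurableSpace E] [BorelSpace E]

theorem measurable_driftStep {b : E → E} (hb : Measurable b) (γ : ℝ) :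
    Measurable (driftStep γ b) := measurable_id.add (hb.const_smul γ)

/-- The kernel of two Euler-Maruyama chains with reflection-coupled noise. -/
noncomputable def coupledChain (γ : ℝ) (b : E → E) (hb : Measurable b) : Kernel (E × E) (E × E) :=
  (reflectionCoupling γ).comap (Prod.map (driftStep γ b) (driftStep γ b))
    ((measurable_driftStep hb γ).prodMap (measurable_driftStep hb γ))

theorem coupledChain_apply (γ : ℝ) (b : E → E) (hb : Measurable b) (q : E × E) :
    coupledChain γ b hb q = couplingMeasure γ (driftStep γ b q.1, driftStep γ b q.2) := rfl

theorem map_fst_coupledChain (γ : ℝ) (b : E → E) (hb : Measurable b) (q : E × E) :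
    (coupledChain γ b hb q).map Prod.fst = eulerMaruyama γ b hb q.1 := by
  rw [coupledChain_apply, map_fst_couplingMeasure]; rfl

theorem map_snd_coupledChain (γ : ℝ) (b : E → E) (hb : Measurable b) (q : E × E) :
    (coupledChain γ b hb q).map Prod.snd = eulerMaruyama γ b hb q.2 := by
  rw [coupledChain_apply, map_snd_couplingMeasure]; rfl

instance isMarkovKernel_eulerMaruyama (γ : ℝ) (b : E → E) (hb : Measurable b) :
    IsMarkovKernel (eulerMaruyama γ b hb) :=
  ⟨fun x => Measure.isProbabilityMeasure_map (μ := stdGaussian E)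
    (f := fun z => x + γ • b x + √γ • z) (by fun_prop)⟩

instance isMarkovKernel_coupledChain (γ : ℝ) (b : E → E) (hb : Measurable b) :
    IsMarkovKernel (coupledChain γ b hb) := by
  refine ⟨fun q => ⟨?_⟩⟩
  have h := map_fst_coupledChain γ b hb q
  rw [← Set.preimage_univ (f := (Prod.fst : E × E → E)),
    ← Measure.map_apply measurable_fst MeasurableSet.univ, h, measure_univ]

theorem coupledChain_pow_mem_transferencePlans (γ : ℝ) (b : E → E) (hb : Measurable b) (k : ℕ)
    (q : E × E) : (coupledChain γ b hb ^ k) q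
      ∈ transferencePlans (eulerMaruyamaLaw γ b hb k q.1) (eulerMaruyamaLaw γ b hb k q.2) :=
  ⟨map_pow_of_intertwining measurable_fst (map_fst_coupledChain γ b hb) k q,
    map_pow_of_intertwining measurable_snd (map_snd_coupledChain γ b hb) k q⟩

theorem wassersteinCost_le (γ : ℝ) (b : E → E) (hb : Measurable b) (k : ℕ) (x y : E)
    (c : E → E → ℝ≥0∞) :
    wassersteinCost c (eulerMaruyamaLaw γ b hb k x) (eulerMaruyamaLaw γ b hb k y)
      ≤ ∫⁻ q, c q.1 q.2 ∂((coupledChain γ b hb ^ k) (x, y)) :=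
  iInf₂_le _ (coupledChain_pow_mem_transferencePlans γ b hb k (x, y))

/-- The one-step formula for odd functions of the distance of the coupled chains. -/
theorem lintegral_coupledChain_odd {γ : ℝ} (hγ : 0 < γ) {b : E → E} (hb : Measurable b)
    (q : E × E) {f : ℝ → ℝ}
    (hf : Measurable f) (hodd : ∀ s, f (-s) = -f s) (hpos : ∀ s, 0 ≤ s → 0 ≤ f s)
    (hint : ∀ u, Integrable (fun g => f (u + 2 * √γ * g)) (gaussianReal 0 1)) :
    ∫⁻ r, ENNReal.ofReal (f ‖r.1 - r.2‖) ∂(coupledChain γ b hb q)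
      = ENNReal.ofReal (∫ g, f (‖driftStep γ b q.1 - driftStep γ b q.2‖ + 2 * √γ * g)
          ∂(gaussianReal 0 1)) :=
  lintegral_couplingMeasure_odd hγ _ hf hodd hpos (hint _)

end CoupledChain

/-! ### Scalar drift inequalities -/

theorem integrable_affine_pow (u c : ℝ) (n : ℕ) :
    Integrable (fun g => (u + c * g) ^ n) (gaussianReal 0 1) := by
  have h : MemLp (fun g : ℝ => u + c * g) n (gaussianReal 0 1) :=
    (memLp_const u).add ((memLp_id_gaussianReal n).const_mul c)
  refine (h.integrable_norm_pow').mono (by fun_prop) (ae_of_all _ fun g => ?_)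
  simp

theorem integrable_one_add_abs_pow (n : ℕ) :
    Integrable (fun g : ℝ => (1 + 2 * |g|) ^ n) (gaussianReal 0 1) := by
  have h : MemLp (fun g : ℝ => 1 + 2 * |g|) n (gaussianReal 0 1) :=
    (memLp_const (1 : ℝ)).add ((memLp_id_gaussianReal n).abs.const_mul 2)
  refine (h.integrable_norm_pow').mono (by fun_prop) (ae_of_all _ fun g => ?_)
  simp

/-- A second-order Taylor bound for `z ↦ (u + z) ^ (n + 2)`. -/
theorem exists_pow_taylor_bound (n : ℕ) : ∃ c : ℝ, 0 ≤ c ∧ ∀ u z : ℝ, 0 ≤ u →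
    |(u + z) ^ (n + 2) - u ^ (n + 2) - (n + 2) * u ^ (n + 1) * z| ≤ c * z ^ 2 * (u + |z|) ^ n := by
  induction n with
  | zero =>
    refine ⟨1, zero_le_one, fun u z _ => le_of_eq ?_⟩
    rw [show (u + z) ^ (0 + 2) - u ^ (0 + 2) - ((0 : ℕ) + 2) * u ^ (0 + 1) * z = z ^ 2 by
      push_cast; ring, abs_of_nonneg (sq_nonneg z)]
    ring
  | succ n ih =>
    obtain ⟨c, hc, h⟩ := ih
    refine ⟨c + (n + 2), by positivity, fun u z hu => ?_⟩
    have h1 : (u + z) ^ (n + 1 + 2) - u ^ (n + 1 + 2) - ((n + 1 : ℕ) + 2) * u ^ (n + 1 + 1) * z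
        = (u + z) * ((u + z) ^ (n + 2) - u ^ (n + 2) - (n + 2) * u ^ (n + 1) * z)
          + (n + 2) * u ^ (n + 1) * z ^ 2 := by
      push_cast; ring
    have h2 : |u + z| ≤ u + |z| := by
      simpa [abs_of_nonneg hu] using abs_add_le u z
    have h3 : u ^ (n + 1) ≤ (u + |z|) ^ (n + 1) := by
      gcongr; linarith [abs_nonneg z]
    rw [h1]
    refine (abs_add_le _ _).trans ?_
    rw [abs_mul, abs_of_nonneg (show 0 ≤ (n + 2) * u ^ (n + 1) * z ^ 2 by positivity)]
    calc _ ≤ (u + |z|) * (c * z ^ 2 * (u + |z|) ^ n) + (n + 2) * (u + |z|) ^ (n + 1) * z ^ 2 := by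
          gcongr
          exact h u z hu
      _ = _ := by ring

/-- Adding a centred Gaussian of variance `4 γ` changes the moment only by `O(γ)`, since the term
of first order vanishes in the mean. -/
theorem exists_gaussian_moment_bound (n : ℕ) : ∃ K : ℝ, 0 ≤ K ∧ ∀ γ u : ℝ, 0 ≤ γ → γ ≤ 1 → 0 ≤ u →
    ∫ g, (u + 2 * √γ * g) ^ (n + 2) ∂(gaussianReal 0 1) ≤ u ^ (n + 2) + γ * (K * (1 + u) ^ n) := by
  obtain ⟨c, hc, hT⟩ := exists_pow_taylor_bound n
  refine ⟨c * ∫ g, (1 + 2 * |g|) ^ (n + 2) ∂(gaussianReal 0 1),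
    mul_nonneg hc (integral_nonneg fun g => by positivity), fun γ u hγ hγ1 hu => ?_⟩
  have hsq : √γ ^ 2 = γ := Real.sq_sqrt hγ
  have hs1 : √γ ≤ 1 := Real.sqrt_le_one.2 hγ1
  have hpt : ∀ g : ℝ, (u + 2 * √γ * g) ^ (n + 2) ≤ (u ^ (n + 2)
      + ((n + 2) * u ^ (n + 1) * (2 * √γ)) * g)
      + γ * (c * (1 + u) ^ n) * (1 + 2 * |g|) ^ (n + 2) := by
    intro g
    have h1 := (abs_le.1 (hT u (2 * √γ * g) hu)).2
    have h2 : |2 * √γ * g| ≤ 2 * |g| := by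
      rw [abs_mul, abs_of_nonneg (by positivity)]
      nlinarith [abs_nonneg g]
    have h3 : (u + |2 * √γ * g|) ^ n ≤ ((1 + u) * (1 + 2 * |g|)) ^ n := by
      gcongr
      nlinarith [abs_nonneg g, mul_nonneg hu (abs_nonneg g)]
    have h4 : (2 * √γ * g) ^ 2 ≤ γ * (1 + 2 * |g|) ^ 2 := by
      rw [mul_pow, mul_pow, hsq, ← sq_abs g]
      nlinarith [abs_nonneg g, mul_nonneg hγ (abs_nonneg g)]
    have h5 : c * (2 * √γ * g) ^ 2 * (u + |2 * √γ * g|) ^ n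
        ≤ c * (γ * (1 + 2 * |g|) ^ 2) * ((1 + u) * (1 + 2 * |g|)) ^ n := by gcongr
    calc (u + 2 * √γ * g) ^ (n + 2) ≤ (u ^ (n + 2) + ((n + 2) * u ^ (n + 1) * (2 * √γ)) * g)
          + c * (γ * (1 + 2 * |g|) ^ 2) * ((1 + u) * (1 + 2 * |g|)) ^ n := by linarith
      _ = _ := by rw [mul_pow (1 + u)]; ring
  have hid : Integrable (fun g : ℝ => g) (gaussianReal 0 1) := by
    simpa using integrable_affine_pow 0 1 1
  have hlin : Integrable (fun g : ℝ => u ^ (n + 2) + ((n + 2) * u ^ (n + 1) * (2 * √γ)) * g)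
      (gaussianReal 0 1) := (integrable_const _).add (hid.const_mul _)
  refine (integral_mono (integrable_affine_pow _ _ _)
    (hlin.add ((integrable_one_add_abs_pow _).const_mul _)) hpt).trans (le_of_eq ?_)
  rw [integral_add' hlin ((integrable_one_add_abs_pow _).const_mul _),
    integral_add (integrable_const _) (hid.const_mul _), integral_const_mul, integral_const_mul,
    integral_id_gaussianReal]
  simp
  ring

theorem exists_pow_le_mul_pow_add (n : ℕ) {ε : ℝ} (hε : 0 < ε) : ∃ B : ℝ, 0 ≤ B ∧
    ∀ x : ℝ, 0 ≤ x → (1 + x) ^ n ≤ ε * x ^ (n + 2) + B := by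
  -- Beyond `1 + 2 ^ n / ε` one has `(1 + x) ^ n ≤ 2 ^ n x ^ n ≤ ε x ^ 2 x ^ n`.
  refine ⟨(1 + (1 + 2 ^ n / ε)) ^ n, by positivity, fun x hx => ?_⟩
  rcases le_total x (1 + 2 ^ n / ε) with h | h
  · have : (1 + x) ^ n ≤ (1 + (1 + 2 ^ n / ε)) ^ n := by gcongr
    have : 0 ≤ ε * x ^ (n + 2) := by positivity
    linarith
  · have hq : 0 ≤ 2 ^ n / ε := by positivity
    have hx1 : 1 ≤ x := by linarith
    have h1 : 2 ^ n ≤ ε * x ^ 2 := by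
      have : 2 ^ n / ε ≤ x ^ 2 := by nlinarith
      rwa [div_le_iff₀' hε] at this
    have h2 : (1 + x) ^ n ≤ (2 * x) ^ n := by gcongr; linarith
    calc (1 + x) ^ n ≤ 2 ^ n * x ^ n := by rwa [mul_pow] at h2
      _ ≤ (ε * x ^ 2) * x ^ n := by gcongr
      _ = ε * x ^ (n + 2) := by ring
      _ ≤ _ := le_add_of_nonneg_right (by positivity)

/-- The drift inequality for moments: here `r` is the distance before and `u` the one after the
drift step. -/
theorem exists_moment_drift (n : ℕ) {L mPlus R : ℝ} (hL : 0 ≤ L) (hm : 0 < mPlus) (hR : 0 ≤ R) :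
    ∃ B : ℝ, 0 ≤ B ∧ ∀ γ r u : ℝ, 0 ≤ γ → γ ≤ 1 → γ * mPlus ≤ 1 → 0 ≤ r → 0 ≤ u →
      u ≤ (1 + γ * L) * r → (R ≤ r → u ≤ (1 - γ * mPlus / 2) * r) →
      ∫ g, (u + 2 * √γ * g) ^ (n + 2) ∂(gaussianReal 0 1)
        ≤ (1 - γ * (mPlus / 4)) * r ^ (n + 2) + γ * B := by
  obtain ⟨K, hK, hmom⟩ := exists_gaussian_moment_bound n
  obtain ⟨B₁, hB₁, hpow⟩ := exists_pow_le_mul_pow_add n (ε := mPlus / 4 / (K + 1)) (by positivity)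
  refine ⟨K * B₁ + ((1 + L) ^ (n + 2) + mPlus / 4) * R ^ (n + 2) + K * (1 + (1 + L) * R) ^ n,
    by positivity, fun γ r u hγ hγ1 hγm hr hu hur hfar => ?_⟩
  refine (hmom γ u hγ hγ1 hu).trans ?_
  rcases le_or_gt R r with h | h
  · have hθ0 : 0 ≤ 1 - γ * mPlus / 2 := by linarith
    have hθ1 : 1 - γ * mPlus / 2 ≤ 1 := by nlinarith
    have h1 : u ^ (n + 2) ≤ (1 - γ * mPlus / 2) * r ^ (n + 2) := by
      calc u ^ (n + 2) ≤ ((1 - γ * mPlus / 2) * r) ^ (n + 2) := by gcongr; exact hfar h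
        _ = (1 - γ * mPlus / 2) ^ (n + 2) * r ^ (n + 2) := mul_pow _ _ _
        _ ≤ (1 - γ * mPlus / 2) * r ^ (n + 2) := by
          gcongr; exact pow_le_of_le_one hθ0 hθ1 (by omega)
    have hu' : u ≤ r := (hfar h).trans (by nlinarith)
    have h2 : K * (1 + u) ^ n ≤ mPlus / 4 * r ^ (n + 2) + K * B₁ := by
      calc K * (1 + u) ^ n ≤ K * (1 + r) ^ n := by gcongr
        _ ≤ K * (mPlus / 4 / (K + 1) * r ^ (n + 2) + B₁) := by gcongr; exact hpow r hr
        _ = (K / (K + 1)) * (mPlus / 4 * r ^ (n + 2)) + K * B₁ := by ring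
        _ ≤ 1 * (mPlus / 4 * r ^ (n + 2)) + K * B₁ := by
          gcongr; rw [div_le_one (by positivity)]; linarith
        _ = _ := by ring
    have h3 : γ * (K * (1 + u) ^ n) ≤ γ * (mPlus / 4 * r ^ (n + 2) + K * B₁) := by gcongr
    have h4 : 0 ≤ γ * (((1 + L) ^ (n + 2) + mPlus / 4) * R ^ (n + 2)
      + K * (1 + (1 + L) * R) ^ n) := by positivity
    linarith
  · have hc : (1 + γ * L) ^ (n + 2) ≤ 1 + γ * (1 + L) ^ (n + 2) := by
      have := (convexOn_pow (𝕜 := ℝ) (n + 2)).2 (Set.mem_Ici.2 zero_le_one)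
        (Set.mem_Ici.2 (show 0 ≤ 1 + L by linarith)) (sub_nonneg.2 hγ1) hγ (sub_add_cancel 1 γ)
      simp only [smul_eq_mul, one_pow, mul_one] at this
      rw [show 1 - γ + γ * (1 + L) = 1 + γ * L by ring] at this
      linarith
    have hrR : r ^ (n + 2) ≤ R ^ (n + 2) := by gcongr
    have h1 : u ^ (n + 2) ≤ r ^ (n + 2) + γ * ((1 + L) ^ (n + 2) * R ^ (n + 2)) := by
      calc u ^ (n + 2) ≤ ((1 + γ * L) * r) ^ (n + 2) := by gcongr
        _ = (1 + γ * L) ^ (n + 2) * r ^ (n + 2) := mul_pow _ _ _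
        _ ≤ (1 + γ * (1 + L) ^ (n + 2)) * r ^ (n + 2) := by gcongr
        _ = r ^ (n + 2) + γ * ((1 + L) ^ (n + 2) * r ^ (n + 2)) := by ring
        _ ≤ _ := by gcongr
    have h2 : u ≤ (1 + L) * R := by
      calc u ≤ (1 + γ * L) * r := hur
        _ ≤ (1 + L) * R := by gcongr; nlinarith
    have h3 : γ * (K * (1 + u) ^ n) ≤ γ * (K * (1 + (1 + L) * R) ^ n) := by gcongr
    have h4 : γ * (mPlus / 4 * r ^ (n + 2)) ≤ γ * (mPlus / 4 * R ^ (n + 2)) := by gcongr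
    have h5 : 0 ≤ γ * (K * B₁) := by positivity
    linarith

/-- The contraction of the concave function `s ↦ A * signMean (s / τ) + s`, where `r` is the
distance before and `u` the one after the drift step; the left-hand side is the mean of the
function after the Gaussian perturbation. -/
theorem exists_concave_contraction {L mPlus R : ℝ} (hL : 0 ≤ L) (hm : 0 < mPlus) :
    ∃ A τ C c : ℝ, 0 ≤ A ∧ 0 < τ ∧ 0 < c ∧ c ≤ 1 ∧ 0 ≤ C ∧
      (∀ s, 0 ≤ s → A * signMean (s / τ) + s ≤ C * s) ∧
      ∀ γ r u : ℝ, 0 ≤ γ → γ ≤ 1 → 0 ≤ r → 0 ≤ u →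
        u ≤ (1 + γ * L) * r → (R ≤ r → u ≤ (1 - γ * mPlus / 2) * r) →
        A * signMean (u / √(τ ^ 2 + (2 * √γ) ^ 2)) + u
          ≤ (1 - c * γ) * (A * signMean (r / τ) + r) := by
  -- `τ` is chosen so that `(1 + γ L) (1 + γ) ≤ √(1 + 4 γ / τ ^ 2)` for all `γ ≤ 1`.
  set D : ℝ := 2 * L + 1 with hD
  set τ : ℝ := 2 / √(D ^ 2 + 2 * D) with hτ
  have hD1 : 1 ≤ D := by linarith
  have hβ : 0 < D ^ 2 + 2 * D := by positivity
  have hτ0 : 0 < τ := by positivity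
  have hτ2 : τ ^ 2 * (D ^ 2 + 2 * D) = 4 := by
    rw [hτ, div_pow, Real.sq_sqrt hβ.le]; field_simp; norm_num
  set φ : ℝ := gaussianPDFReal 0 1 (R / τ) with hφ
  have hφ0 : 0 < φ := gaussianPDFReal_pos _ _ _ one_ne_zero
  -- `A` makes the gain of the `signMean` term at least `(L + 1) γ r` for `r < R`.
  set A : ℝ := (L + 1) * τ / φ with hA
  have hA0 : 0 ≤ A := by positivity
  set C : ℝ := A / τ + 1 with hC
  have hC1 : 1 ≤ C := by
    have : 0 ≤ A / τ := by positivity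
    linarith
  set c₂ : ℝ := min 1 (mPlus / 2) with hc₂
  have hc₂0 : 0 < c₂ := lt_min one_pos (by positivity)
  have hFC : ∀ s, 0 ≤ s → A * signMean (s / τ) + s ≤ C * s := fun s hs => by
    have h := signMean_sub_le (s := s / τ) (t := 0) (by positivity)
    rw [signMean_zero, sub_zero, sub_zero] at h
    calc A * signMean (s / τ) + s ≤ A * (s / τ) + s := by gcongr
      _ = C * s := by rw [hC]; ring
  refine ⟨A, τ, C, c₂ / C, hA0, hτ0, by positivity, ?_, by linarith, hFC, ?_⟩
  · rw [div_le_one (by linarith)]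
    exact (min_le_left _ _).trans hC1
  intro γ r u hγ hγ1 hr hu hur hfar
  have hsq : √γ ^ 2 = γ := Real.sq_sqrt hγ
  have hden : τ * ((1 + γ * L) * (1 + γ)) ≤ √(τ ^ 2 + (2 * √γ) ^ 2) := by
    apply Real.le_sqrt_of_sq_le
    have h1 : (1 + γ * L) * (1 + γ) ≤ 1 + γ * D := by
      have : γ * (γ * L) ≤ 1 * (γ * L) := by gcongr
      rw [hD]; linarith
    have h2 : ((1 + γ * L) * (1 + γ)) ^ 2 ≤ 1 + γ * (D ^ 2 + 2 * D) := by
      calc ((1 + γ * L) * (1 + γ)) ^ 2 ≤ (1 + γ * D) ^ 2 := by gcongr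
        _ = 1 + γ * (γ * D ^ 2 + 2 * D) := by ring
        _ ≤ 1 + γ * (1 * D ^ 2 + 2 * D) := by gcongr
        _ = _ := by ring
    calc (τ * ((1 + γ * L) * (1 + γ))) ^ 2 = τ ^ 2 * ((1 + γ * L) * (1 + γ)) ^ 2 := mul_pow _ _ _
      _ ≤ τ ^ 2 * (1 + γ * (D ^ 2 + 2 * D)) := by gcongr
      _ = τ ^ 2 + γ * (τ ^ 2 * (D ^ 2 + 2 * D)) := by ring
      _ = τ ^ 2 + (2 * √γ) ^ 2 := by rw [hτ2, mul_pow, hsq]; ring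
  have harg : u / √(τ ^ 2 + (2 * √γ) ^ 2) ≤ r / τ / (1 + γ) := by
    calc u / √(τ ^ 2 + (2 * √γ) ^ 2) ≤ ((1 + γ * L) * r) / (τ * ((1 + γ * L) * (1 + γ))) := by
          gcongr
      _ = r / τ / (1 + γ) := by field_simp
  have hle : r / τ / (1 + γ) ≤ r / τ := div_le_self (by positivity) (by linarith)
  have hmono := monotone_signMean harg
  have hmono2 := monotone_signMean hle
  have hF := hFC r hr
  have key : A * signMean (u / √(τ ^ 2 + (2 * √γ) ^ 2)) + u
      ≤ (A * signMean (r / τ) + r) - c₂ * γ * r := by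
    -- Far away the linear term contracts, nearby the `signMean` term does.
    rcases le_or_gt R r with h | h
    · have h1 : c₂ * γ * r ≤ mPlus / 2 * γ * r := by gcongr; exact min_le_right _ _
      have h2 := hfar h
      have h3 := mul_le_mul_of_nonneg_left (hmono.trans hmono2) hA0
      linarith
    · have h1 : 2 * φ * (r / τ - r / τ / (1 + γ))
          ≤ signMean (r / τ) - signMean (r / τ / (1 + γ)) :=
        le_signMean_sub (by positivity) hle (by gcongr)
      have h2 : r / τ * (γ / 2) ≤ r / τ - r / τ / (1 + γ) := by
        rw [show r / τ - r / τ / (1 + γ) = r / τ * (γ / (1 + γ)) by field_simp; ring]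
        gcongr
        linarith
      have h3 : (L + 1) * (γ * r) ≤ A * (signMean (r / τ) - signMean (r / τ / (1 + γ))) := by
        calc (L + 1) * (γ * r) = A * (2 * φ * (r / τ * (γ / 2))) := by
              rw [hA]; field_simp
          _ ≤ A * (2 * φ * (r / τ - r / τ / (1 + γ))) := by gcongr
          _ ≤ _ := by gcongr
      have h4 := mul_le_mul_of_nonneg_left hmono hA0
      have h5 : c₂ * γ * r ≤ 1 * γ * r := by gcongr; exact min_le_left _ _
      linarith
  have h6 : c₂ / C * γ * (A * signMean (r / τ) + r) ≤ c₂ * γ * r := by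
    calc c₂ / C * γ * (A * signMean (r / τ) + r) ≤ c₂ / C * γ * (C * r) := by gcongr
      _ = c₂ * γ * r := by field_simp
  linarith

/-! ### Estimates for the coupled chain -/

theorem integrable_signMean_comp (τ u σ : ℝ) :
    Integrable (fun g => signMean ((u + σ * g) / τ)) (gaussianReal 0 1) :=
  Integrable.of_bound
    (monotone_signMean.measurable.comp (by fun_prop)).aestronglyMeasurable 1
    (ae_of_all _ fun _ => abs_signMean_le_one _)

theorem offDiag_eq_ofReal_sign {E : Type*} [NormedAddCommGroup E] (x y : E) :
    offDiag x y = ENNReal.ofReal (Real.sign ‖x - y‖) := by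
  unfold offDiag
  split_ifs with h
  · simp [h]
  · rw [Real.sign_of_pos (norm_sub_pos_iff.2 h), ENNReal.ofReal_one]

section ChainEstimates

variable {E : Type*} [NormedAddCommGroup E] [InnerProductSpace ℝ E] [FiniteDimensional ℝ E]
  [MeasurableSpace E] [BorelSpace E]

/-- Geometric decay of the mean distance, from the one-step contraction of a concave function
comparable to the distance. -/
theorem lintegral_norm_sub_coupledChain_pow_le {γ : ℝ} (hγ : 0 < γ) {b : E → E}
    (hb : Measurable b) {A τ C κ : ℝ} (hA : 0 ≤ A) (hτ : 0 < τ) (hκ : 0 ≤ κ)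
    (hC : ∀ s, 0 ≤ s → A * signMean (s / τ) + s ≤ C * s)
    (hdrift : ∀ x y : E, A * signMean (‖driftStep γ b x - driftStep γ b y‖
        / √(τ ^ 2 + (2 * √γ) ^ 2)) + ‖driftStep γ b x - driftStep γ b y‖
      ≤ κ * (A * signMean (‖x - y‖ / τ) + ‖x - y‖)) (k : ℕ) (p : E × E) :
    ∫⁻ q, ENNReal.ofReal ‖q.1 - q.2‖ ∂((coupledChain γ b hb ^ k) p)
      ≤ ENNReal.ofReal (C * κ ^ k * ‖p.1 - p.2‖) := by
  set F : ℝ → ℝ := fun s => A * signMean (s / τ) + s with hF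
  have hFm : Measurable F :=
    ((monotone_signMean.measurable.comp (measurable_id.div_const τ)).const_mul A).add measurable_id
  have hFpos : ∀ s, 0 ≤ s → s ≤ F s := fun s hs =>
    le_add_of_nonneg_left (mul_nonneg hA (signMean_nonneg (by positivity)))
  have hstep : ∀ q : E × E, ∫⁻ r, ENNReal.ofReal (F ‖r.1 - r.2‖) ∂(coupledChain γ b hb q)
      ≤ ENNReal.ofReal κ * ENNReal.ofReal (F ‖q.1 - q.2‖) + 0 := by
    intro q
    have h1 : ∀ u, Integrable (fun g => A * signMean ((u + 2 * √γ * g) / τ)) (gaussianReal 0 1) :=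
      fun u => (integrable_signMean_comp τ u _).const_mul A
    have h2 : ∀ u, Integrable (fun g => u + 2 * √γ * g) (gaussianReal 0 1) := fun u => by
      simpa using integrable_affine_pow u (2 * √γ) 1
    rw [lintegral_coupledChain_odd hγ hb q hFm
      (fun s => by simp only [hF, neg_div, signMean_neg]; ring)
      (fun s hs => hs.trans (hFpos s hs)) (fun u => (h1 u).add (h2 u)),
      ← ENNReal.ofReal_mul hκ, add_zero]
    refine ENNReal.ofReal_le_ofReal (le_trans (le_of_eq ?_) (hdrift q.1 q.2))
    simp only [hF]
    have hid : Integrable (fun g : ℝ => g) (gaussianReal 0 1) := by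
      simpa using integrable_affine_pow 0 1 1
    rw [integral_add (h1 _) (h2 _), integral_const_mul,
      integral_signMean_add_mul (mul_pos two_pos (Real.sqrt_pos.2 hγ)) hτ,
      integral_add (integrable_const _) (hid.const_mul _), integral_const_mul,
      integral_id_gaussianReal]
    simp
  calc ∫⁻ q, ENNReal.ofReal ‖q.1 - q.2‖ ∂((coupledChain γ b hb ^ k) p)
      ≤ ∫⁻ q, ENNReal.ofReal (F ‖q.1 - q.2‖) ∂((coupledChain γ b hb ^ k) p) :=
        lintegral_mono fun q => ENNReal.ofReal_le_ofReal (hFpos _ (norm_nonneg _))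
    _ ≤ ENNReal.ofReal κ ^ k * ENNReal.ofReal (F ‖p.1 - p.2‖) + 0 :=
        lintegral_pow_le_of_drift (by fun_prop) hstep (by simp) k p
    _ = ENNReal.ofReal (κ ^ k * F ‖p.1 - p.2‖) := by
        rw [add_zero, ← ENNReal.ofReal_pow hκ, ← ENNReal.ofReal_mul (by positivity)]
    _ ≤ ENNReal.ofReal (C * κ ^ k * ‖p.1 - p.2‖) := by
        refine ENNReal.ofReal_le_ofReal ?_
        rw [mul_comm C, mul_assoc]
        gcongr
        exact hC _ (norm_nonneg _)

theorem lintegral_offDiag_coupledChain {γ : ℝ} (hγ : 0 < γ) {b : E → E} (hb : Measurable b)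
    (p : E × E) : ∫⁻ q, offDiag q.1 q.2 ∂(coupledChain γ b hb p)
      = ENNReal.ofReal (signMean (‖driftStep γ b p.1 - driftStep γ b p.2‖ / (2 * √γ))) := by
  simp only [offDiag_eq_ofReal_sign]
  rw [lintegral_coupledChain_odd hγ hb p measurable_realSign (fun s => Real.sign_neg)
    (fun s hs => by simpa using monotone_realSign hs)
    (fun u => integrable_realSign_comp (by fun_prop)),
    integral_sign_add_mul (mul_pos two_pos (Real.sqrt_pos.2 hγ))]

theorem measurable_offDiag : Measurable fun q : E × E => offDiag q.1 q.2 := by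
  simp only [offDiag_eq_ofReal_sign]
  fun_prop

/-- The probability that the chains have not met after `n + 1` steps. Each step widens the scale
`t` of `signMean (r / t)` to `√(t ^ 2 + 4 γ)` and shrinks it by the factor `1 + γ L` of the drift
step. -/
theorem lintegral_offDiag_coupledChain_pow_succ_le {γ : ℝ} (hγ : 0 < γ) {b : E → E}
    (hb : Measurable b) {L : ℝ} (hL : 0 ≤ L) (hLip : ∀ x y, ‖b x - b y‖ ≤ L * ‖x - y‖)
    (n : ℕ) (p : E × E) :
    ∫⁻ q, offDiag q.1 q.2 ∂((coupledChain γ b hb ^ (n + 1)) p)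
      ≤ ENNReal.ofReal (signMean (‖p.1 - p.2‖ * (1 + γ * L) ^ (n + 1) / (2 * √(γ * (n + 1))))) := by
  have hsq : √γ ^ 2 = γ := Real.sq_sqrt hγ.le
  have hs : 0 < √γ := Real.sqrt_pos.2 hγ
  have hG : 1 ≤ 1 + γ * L := le_add_of_nonneg_right (by positivity)
  induction n generalizing p with
  | zero =>
    rw [zero_add, pow_one, pow_one, lintegral_offDiag_coupledChain hγ hb]
    refine ENNReal.ofReal_le_ofReal (monotone_signMean ?_)
    rw [Nat.cast_zero, zero_add, mul_one, mul_comm ‖p.1 - p.2‖]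
    gcongr
    exact norm_driftStep_sub_le hLip hγ.le _ _
  | succ n ih =>
    set G := 1 + γ * L with hGdef
    have hn1 : (0 : ℝ) < n + 1 := by positivity
    set t := 2 * √(γ * (n + 1)) / G ^ (n + 1) with ht
    have hsq2 : √(γ * (n + 1)) ^ 2 = γ * (n + 1) := Real.sq_sqrt (by positivity)
    have ht0 : 0 < t := by positivity
    have hdiv : ∀ s : ℝ, s * G ^ (n + 1) / (2 * √(γ * (n + 1))) = s / t := fun s => by
      rw [ht, div_div_eq_mul_div]
    rw [lintegral_pow_add _ (n + 1) 1 _ measurable_offDiag, pow_one]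
    refine (lintegral_mono fun c => ih c).trans ?_
    simp only [hdiv]
    rw [lintegral_coupledChain_odd hγ hb p (f := fun s => signMean (s / t))
      (monotone_signMean.measurable.comp (measurable_id.div_const t))
      (fun s => by rw [neg_div, signMean_neg]) (fun s hs => signMean_nonneg (by positivity))
      (fun u => integrable_signMean_comp t u _), integral_signMean_add_mul (by positivity) ht0]
    refine ENNReal.ofReal_le_ofReal (monotone_signMean ?_)
    have hden : 2 * √(γ * (n + 1 + 1)) / G ^ (n + 1) ≤ √(t ^ 2 + (2 * √γ) ^ 2) := by
      apply Real.le_sqrt_of_sq_le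
      have h1 : (2 * √γ) ^ 2 / (G ^ (n + 1)) ^ 2 ≤ (2 * √γ) ^ 2 :=
        div_le_self (by positivity) (one_le_pow₀ (one_le_pow₀ hG))
      rw [ht, div_pow, div_pow, mul_pow, mul_pow, Real.sq_sqrt (by positivity), hsq2]
      rw [mul_pow, hsq] at h1 ⊢
      calc 2 ^ 2 * (γ * (n + 1 + 1)) / (G ^ (n + 1)) ^ 2
          = 2 ^ 2 * (γ * (n + 1)) / (G ^ (n + 1)) ^ 2 + 2 ^ 2 * γ / (G ^ (n + 1)) ^ 2 := by ring
        _ ≤ _ := by gcongr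
    push_cast
    calc ‖driftStep γ b p.1 - driftStep γ b p.2‖ / √(t ^ 2 + (2 * √γ) ^ 2)
        ≤ (G * ‖p.1 - p.2‖) / (2 * √(γ * (n + 1 + 1)) / G ^ (n + 1)) := by
          gcongr
          exact norm_driftStep_sub_le hLip hγ.le _ _
      _ = ‖p.1 - p.2‖ * G ^ (n + 1 + 1) / (2 * √(γ * (n + 1 + 1))) := by
          rw [div_div_eq_mul_div]; ring

theorem lintegral_offDiag_coupledChain_pow_le_one {γ : ℝ} (hγ : 0 < γ) {b : E → E}
    (hb : Measurable b) (k : ℕ) (p : E × E) :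
    ∫⁻ q, offDiag q.1 q.2 ∂((coupledChain γ b hb ^ k) p) ≤ offDiag p.1 p.2 := by
  have h : ∀ q : E × E, ∫⁻ r, offDiag r.1 r.2 ∂(coupledChain γ b hb q)
      ≤ 1 * offDiag q.1 q.2 + 0 := fun q => by
    rw [lintegral_offDiag_coupledChain hγ hb, one_mul, add_zero]
    unfold offDiag
    split_ifs with h
    · simp [h, signMean_zero]
    · rw [← ENNReal.ofReal_one]
      exact ENNReal.ofReal_le_ofReal ((le_abs_self _).trans (abs_signMean_le_one _))
  simpa using lintegral_pow_le_of_drift measurable_offDiag h (B := 0) (by simp) k p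

/-- After a unit of time, that is the least number of steps above `1 / γ`, the probability that
the chains have not met is at most proportional to their initial distance. -/
theorem lintegral_offDiag_coupledChain_unit_time_le {γ : ℝ} (hγ : 0 < γ) (hγ1 : γ ≤ 1) {b : E → E}
    (hb : Measurable b) {L : ℝ} (hL : 0 ≤ L) (hLip : ∀ x y, ‖b x - b y‖ ≤ L * ‖x - y‖)
    (p : E × E) :
    ∫⁻ q, offDiag q.1 q.2 ∂((coupledChain γ b hb ^ (⌊γ⁻¹⌋₊ + 1)) p)
      ≤ ENNReal.ofReal (Real.exp (2 * L) * ‖p.1 - p.2‖) := by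
  refine (lintegral_offDiag_coupledChain_pow_succ_le hγ hb hL hLip _ p).trans
    (ENNReal.ofReal_le_ofReal ?_)
  set n := ⌊γ⁻¹⌋₊ with hn
  have h1 : 1 ≤ γ * (n + 1) := by
    calc 1 = γ * γ⁻¹ := (mul_inv_cancel₀ hγ.ne').symm
      _ ≤ γ * (n + 1) := by gcongr; exact (Nat.lt_floor_add_one γ⁻¹).le
  have h2 : γ * (n + 1) ≤ 2 := by
    have : γ * n ≤ 1 := by
      rw [← mul_inv_cancel₀ hγ.ne']
      gcongr
      exact Nat.floor_le (by positivity)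
    linarith
  have h3 : (1 + γ * L) ^ (n + 1) ≤ Real.exp (2 * L) := by
    calc (1 + γ * L) ^ (n + 1) ≤ Real.exp (γ * L) ^ (n + 1) := by
          gcongr; rw [add_comm]; exact Real.add_one_le_exp _
      _ = Real.exp (γ * (n + 1) * L) := by rw [← Real.exp_nat_mul]; push_cast; ring_nf
      _ ≤ Real.exp (2 * L) := by gcongr
  have h4 : 1 ≤ 2 * √(γ * (n + 1)) := by
    have := Real.one_le_sqrt.2 h1
    linarith
  have h5 : ∀ s : ℝ, 0 ≤ s → signMean s ≤ s := fun s hs => by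
    simpa [signMean_zero] using signMean_sub_le hs
  calc signMean (‖p.1 - p.2‖ * (1 + γ * L) ^ (n + 1) / (2 * √(γ * (n + 1))))
      ≤ ‖p.1 - p.2‖ * (1 + γ * L) ^ (n + 1) / (2 * √(γ * (n + 1))) := h5 _ (by positivity)
    _ ≤ ‖p.1 - p.2‖ * (1 + γ * L) ^ (n + 1) := div_le_self (by positivity) h4
    _ ≤ ‖p.1 - p.2‖ * Real.exp (2 * L) := by gcongr
    _ = _ := mul_comm _ _

/-- Exponential decay of the probability that the chains have not met: the mean distance decays
until one unit of time before the end, and the last unit turns it into a probability. -/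
theorem lintegral_offDiag_coupledChain_pow_le {γ : ℝ} (hγ : 0 < γ) (hγ1 : γ ≤ 1) {b : E → E}
    (hb : Measurable b) {L : ℝ} (hL : 0 ≤ L) (hLip : ∀ x y, ‖b x - b y‖ ≤ L * ‖x - y‖)
    {C c : ℝ} (hC : 0 ≤ C) (hc : 0 ≤ c)
    (hmean : ∀ (k : ℕ) (p : E × E), ∫⁻ q, ENNReal.ofReal ‖q.1 - q.2‖ ∂((coupledChain γ b hb ^ k) p)
      ≤ ENNReal.ofReal (C * Real.exp (-(c * (k * γ))) * ‖p.1 - p.2‖)) (k : ℕ) (p : E × E) :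
    ∫⁻ q, offDiag q.1 q.2 ∂((coupledChain γ b hb ^ k) p)
      ≤ ENNReal.ofReal (Real.exp (2 * c) * Real.exp (-(c * (k * γ))))
        * (offDiag p.1 p.2 + ENNReal.ofReal (Real.exp (2 * L) * C * ‖p.1 - p.2‖)) := by
  set n := ⌊γ⁻¹⌋₊ + 1 with hn
  have hnγ : n * γ ≤ 2 := by
    have : ⌊γ⁻¹⌋₊ * γ ≤ 1 := by
      rw [← inv_mul_cancel₀ hγ.ne']
      gcongr
      exact Nat.floor_le (by positivity)
    rw [hn]; push_cast; linarith
  rw [mul_add, ← ENNReal.ofReal_mul (by positivity), ← Real.exp_add]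
  -- With less than a unit of time elapsed, the constant `exp (2 c)` absorbs the exponential factor.
  rcases le_total n k with h | h
  · refine le_add_of_nonneg_of_le zero_le ?_
    obtain ⟨j, rfl⟩ := Nat.exists_eq_add_of_le h
    rw [lintegral_pow_add _ n j p measurable_offDiag]
    calc ∫⁻ q, ∫⁻ r, offDiag r.1 r.2 ∂((coupledChain γ b hb ^ n) q) ∂((coupledChain γ b hb ^ j) p)
        ≤ ∫⁻ q, ENNReal.ofReal (Real.exp (2 * L)) * ENNReal.ofReal ‖q.1 - q.2‖
            ∂((coupledChain γ b hb ^ j) p) := lintegral_mono fun q => by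
          rw [← ENNReal.ofReal_mul (Real.exp_nonneg _)]
          exact lintegral_offDiag_coupledChain_unit_time_le hγ hγ1 hb hL hLip q
      _ = ENNReal.ofReal (Real.exp (2 * L)) * ∫⁻ q, ENNReal.ofReal ‖q.1 - q.2‖
            ∂((coupledChain γ b hb ^ j) p) := lintegral_const_mul _ (by fun_prop)
      _ ≤ ENNReal.ofReal (Real.exp (2 * L))
            * ENNReal.ofReal (C * Real.exp (-(c * (j * γ))) * ‖p.1 - p.2‖) := by
          gcongr; exact hmean j p
      _ ≤ _ := by
          rw [← ENNReal.ofReal_mul (Real.exp_nonneg _)]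
          refine ENNReal.ofReal_le_ofReal ?_
          have : Real.exp (-(c * (j * γ))) ≤ Real.exp (2 * c + -(c * ((n + j : ℕ) * γ))) := by
            gcongr
            have := mul_le_mul_of_nonneg_left hnγ hc
            push_cast
            linarith
          calc _ = Real.exp (-(c * (j * γ))) * (Real.exp (2 * L) * C * ‖p.1 - p.2‖) := by ring
            _ ≤ _ := by gcongr
  · refine le_add_of_le_of_nonneg ?_ zero_le
    refine (lintegral_offDiag_coupledChain_pow_le_one hγ hb k p).trans ?_
    have hk : (k : ℝ) * γ ≤ n * γ := by gcongr
    have := mul_le_mul_of_nonneg_left (hk.trans hnγ) hc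
    calc offDiag p.1 p.2 = 1 * offDiag p.1 p.2 := (one_mul _).symm
      _ ≤ _ := by
        gcongr
        rw [← ENNReal.ofReal_one]
        exact ENNReal.ofReal_le_ofReal (Real.one_le_exp (by linarith))

/-- Odd moments of the distance stay bounded uniformly in the number of steps. -/
theorem lintegral_pow_norm_sub_coupledChain_pow_le {γ : ℝ} (hγ : 0 < γ) {b : E → E}
    (hb : Measurable b) {N : ℕ} (hN : Odd N) {a B : ℝ} (ha : 0 < a) (haγ : γ * a ≤ 1) (hB : 0 ≤ B)
    (hdrift : ∀ x y : E,
      ∫ g, (‖driftStep γ b x - driftStep γ b y‖ + 2 * √γ * g) ^ N ∂(gaussianReal 0 1)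
        ≤ (1 - γ * a) * ‖x - y‖ ^ N + γ * B) (k : ℕ) (p : E × E) :
    ∫⁻ q, ENNReal.ofReal (‖q.1 - q.2‖ ^ N) ∂((coupledChain γ b hb ^ k) p)
      ≤ ENNReal.ofReal (‖p.1 - p.2‖ ^ N + B / a) := by
  have h0 : 0 ≤ 1 - γ * a := by linarith
  have hstep : ∀ q : E × E, ∫⁻ r, ENNReal.ofReal (‖r.1 - r.2‖ ^ N) ∂(coupledChain γ b hb q)
      ≤ ENNReal.ofReal (1 - γ * a) * ENNReal.ofReal (‖q.1 - q.2‖ ^ N)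
        + ENNReal.ofReal (γ * B) := fun q => by
    rw [lintegral_coupledChain_odd hγ hb q (f := fun s => s ^ N) (by fun_prop)
      (fun s => hN.neg_pow s) (fun s hs => by positivity) (fun u => integrable_affine_pow u _ N),
      ← ENNReal.ofReal_mul h0, ← ENNReal.ofReal_add (by positivity) (by positivity)]
    exact ENNReal.ofReal_le_ofReal (hdrift q.1 q.2)
  have hfix : ENNReal.ofReal (1 - γ * a) * ENNReal.ofReal (B / a) + ENNReal.ofReal (γ * B)
      ≤ ENNReal.ofReal (B / a) := by
    rw [← ENNReal.ofReal_mul h0, ← ENNReal.ofReal_add (by positivity) (by positivity)]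
    refine ENNReal.ofReal_le_ofReal (le_of_eq ?_)
    field_simp
    ring
  refine (lintegral_pow_le_of_drift (by fun_prop) hstep hfix k p).trans ?_
  rw [ENNReal.ofReal_add (by positivity) (by positivity)]
  gcongr
  refine mul_le_of_le_one_left' (pow_le_one' ?_ k)
  rw [← ENNReal.ofReal_one]
  exact ENNReal.ofReal_le_ofReal (by nlinarith)

end ChainEstimates

/-! ### Transport costs and interpolation of moments -/

theorem offDiag_le_mixedCost {E : Type*} [NormedAddCommGroup E] (R : ℝ) (x y : E) :
    offDiag x y ≤ mixedCost R x y :=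
  le_mul_of_one_le_right' le_self_add

theorem wassersteinCost_self {E : Type*} [MeasurableSpace E] {c : E → E → ℝ≥0∞}
    (hc : ∀ x, c x x = 0) (μ : Measure E) : wassersteinCost c μ μ = 0 := by
  have hd : Measurable fun x : E => (x, x) := measurable_id.prodMk measurable_id
  refine le_antisymm ((iInf₂_le (μ.map fun x => (x, x)) ⟨?_, ?_⟩).trans ?_) zero_le
  · refine (lintegral_map_le _ _).trans ?_
    simp [hc]
  · rw [Measure.map_map measurable_fst hd]; exact Measure.map_id
  · rw [Measure.map_map measurable_snd hd]; exact Measure.map_id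

/-- The easy half of the coupling characterisation of the total variation distance. -/
theorem tvDist_le_wassersteinCost {E : Type*} [MeasurableSpace E] {μ ν : Measure E}
    [IsProbabilityMeasure μ]
    [IsProbabilityMeasure ν] {c : E → E → ℝ≥0∞} (hc : ∀ x y, offDiag x y ≤ c x y) :
    tvDist μ ν ≤ wassersteinCost c μ ν := by
  refine le_iInf₂ fun ζ hζ => ?_
  obtain ⟨h1, h2⟩ := hζ
  have hprob : IsProbabilityMeasure ζ := ⟨by
    rw [← Set.preimage_univ (f := (Prod.fst : E × E → E)),
      ← Measure.map_apply measurable_fst MeasurableSet.univ, h1, measure_univ]⟩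
  refine ENNReal.div_le_of_le_mul (iSup_le fun ⟨f, hf, hf1⟩ => ?_)
  have hint : ∀ {g : E × E → E}, Measurable g → Integrable (fun q => f (g q)) ζ := fun hg =>
    Integrable.of_bound (hf.comp hg).aestronglyMeasurable 1 (ae_of_all _ fun q => hf1 _)
  rw [← h1, ← h2, integral_map measurable_fst.aemeasurable hf.aestronglyMeasurable,
    integral_map measurable_snd.aemeasurable hf.aestronglyMeasurable,
    ← integral_sub (hint measurable_fst) (hint measurable_snd), ← Real.enorm_eq_ofReal_abs]
  refine (enorm_integral_le_lintegral_enorm _).trans ?_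
  rw [mul_comm, ← lintegral_const_mul' _ _ (by simp)]
  refine lintegral_mono fun q => ?_
  refine le_trans ?_ (mul_le_mul_right (hc q.1 q.2) 2)
  unfold offDiag
  split_ifs with h
  · simp [h]
  · rw [mul_one, Real.enorm_eq_ofReal_abs, show (2 : ℝ≥0∞) = ENNReal.ofReal 2 by simp]
    refine ENNReal.ofReal_le_ofReal ?_
    have h3 := abs_le.1 (hf1 q.1)
    have h4 := abs_le.1 (hf1 q.2)
    exact abs_le.2 ⟨by linarith, by linarith⟩

theorem lintegral_mixedCost_le {E : Type*} [NormedAddCommGroup E] [MeasurableSpace E]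
    {ζ : Measure (E × E)} (R : ℝ)
    (hm : Measurable fun q : E × E => offDiag q.1 q.2)
    (hn : Measurable fun q : E × E => ENNReal.ofReal ‖q.1 - q.2‖) :
    ∫⁻ q, mixedCost R q.1 q.2 ∂ζ ≤ ∫⁻ q, offDiag q.1 q.2 ∂ζ
      + (∫⁻ q, ENNReal.ofReal ‖q.1 - q.2‖ ∂ζ) / ENNReal.ofReal R := by
  simp only [div_eq_mul_inv]
  rw [← lintegral_mul_const _ hn, ← lintegral_add_left hm]
  refine lintegral_mono fun q => ?_
  unfold mixedCost offDiag
  split_ifs with h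
  · simp
  · simp [div_eq_mul_inv]

theorem le_mul_mixedCost {E : Type*} [NormedAddCommGroup E] {R a₁ a₂ K : ℝ}
    (hR : 0 < R) (ha₁ : 0 ≤ a₁) (ha₂ : 0 ≤ a₂)
    (h₁ : a₁ ≤ K) (h₂ : a₂ * R ≤ K) (x y : E) :
    ENNReal.ofReal a₁ * offDiag x y + ENNReal.ofReal (a₂ * ‖x - y‖)
      ≤ ENNReal.ofReal K * mixedCost R x y := by
  unfold mixedCost offDiag
  split_ifs with h
  · simp [h]
  · rw [mul_one, one_mul, ← ENNReal.ofReal_div_of_pos hR, ← ENNReal.ofReal_one,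
      ← ENNReal.ofReal_add zero_le_one (by positivity),
      ← ENNReal.ofReal_add ha₁ (by positivity), ← ENNReal.ofReal_mul (ha₁.trans h₁)]
    refine ENNReal.ofReal_le_ofReal ?_
    have h3 : a₂ * ‖x - y‖ ≤ K * (‖x - y‖ / R) := by
      calc a₂ * ‖x - y‖ = a₂ * R * (‖x - y‖ / R) := by field_simp
        _ ≤ _ := by gcongr
    linarith

theorem mixedCost_zero_of_ne {E : Type*} [NormedAddCommGroup E] {x y : E} (h : x ≠ y) :
    mixedCost 0 x y = ⊤ := by
  have : ENNReal.ofReal ‖x - y‖ ≠ 0 := by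
    simpa using norm_sub_pos_iff.2 h
  rw [mixedCost, ENNReal.ofReal_zero, ENNReal.div_zero this]
  simp [offDiag, h]

/-- Hölder's inequality in the form of an interpolation of the `p`-th moment between the first and
the `N`-th one. -/
theorem lintegral_pow_le_interpolation {Ω : Type*} [MeasurableSpace Ω] {ζ : Measure Ω}
    {r : Ω → ℝ} (hr : Measurable r) (hr0 : ∀ ω, 0 ≤ r ω) {p N : ℕ} {θ : ℝ}
    (hθ0 : 0 ≤ θ) (hθ1 : θ ≤ 1) (hθ : θ + N * (1 - θ) = p) :
    ∫⁻ ω, ENNReal.ofReal (r ω ^ p) ∂ζ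
      ≤ (∫⁻ ω, ENNReal.ofReal (r ω) ∂ζ) ^ θ * (∫⁻ ω, ENNReal.ofReal (r ω ^ N) ∂ζ) ^ (1 - θ) := by
  refine le_trans (le_of_eq ?_) (ENNReal.lintegral_mul_norm_pow_le (by fun_prop) (by fun_prop)
    hθ0 (sub_nonneg.2 hθ1) (by ring))
  refine lintegral_congr fun ω => ?_
  have h1 : (0 : ℝ) ≤ N * (1 - θ) := mul_nonneg (by positivity) (sub_nonneg.2 hθ1)
  rw [ENNReal.ofReal_rpow_of_nonneg (hr0 ω) hθ0,
    ENNReal.ofReal_rpow_of_nonneg (pow_nonneg (hr0 ω) N) (sub_nonneg.2 hθ1),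
    ← ENNReal.ofReal_mul (Real.rpow_nonneg (hr0 ω) _), ← Real.rpow_natCast (r ω) N,
    ← Real.rpow_mul (hr0 ω), ← Real.rpow_add_of_nonneg (hr0 ω) hθ0 h1, hθ, Real.rpow_natCast]

theorem interpolated_moment_le {C B e r : ℝ} (hC : 0 ≤ C) (hB : 0 ≤ B) (he : 0 < e) (he1 : e ≤ 1)
    (hr : 0 ≤ r) {N : ℕ} {s t α : ℝ} (hα : 1 ≤ α) (hs : 1 / α ≤ s) (hs1 : s ≤ 1) (ht : 0 ≤ t)
    (ht1 : t ≤ 1) (hst : s + N * t = 1) :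
    (C * e * r) ^ s * (r ^ N + B) ^ t
      ≤ (1 + C) * (2 + B) * e ^ (1 / α) * (r + r ^ (1 / α)) := by
  have hα0 : 0 < 1 / α := by positivity
  have hs0 : 0 < s := hα0.trans_le hs
  have h1 : (r ^ N + B) ^ t ≤ r ^ (N * t) + (1 + B) := by
    have h := Real.rpow_add_le_add_rpow (pow_nonneg hr N) hB ht ht1
    rw [← Real.rpow_natCast, ← Real.rpow_mul hr] at h
    have hBt : B ^ t ≤ 1 + B := by
      calc B ^ t ≤ (1 + B) ^ t := by gcongr; linarith
        _ ≤ (1 + B) ^ (1 : ℝ) := by gcongr; linarith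
        _ = 1 + B := Real.rpow_one _
    rw [Real.rpow_natCast] at h
    linarith
  have h2 : C ^ s ≤ 1 + C := by
    calc C ^ s ≤ (1 + C) ^ s := by gcongr; linarith
      _ ≤ (1 + C) ^ (1 : ℝ) := by gcongr; linarith
      _ = 1 + C := Real.rpow_one _
  have h3 : e ^ s ≤ e ^ (1 / α) := Real.rpow_le_rpow_of_exponent_ge he he1 hs
  have h4 : r ^ s ≤ r + r ^ (1 / α) := by
    rcases le_total r 1 with h | h
    · have : r ^ s ≤ r ^ (1 / α) := Real.rpow_le_rpow_of_exponent_ge' hr h hα0.le hs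
      linarith
    · have : r ^ s ≤ r ^ (1 : ℝ) := by gcongr
      rw [Real.rpow_one] at this
      have : 0 ≤ r ^ (1 / α) := by positivity
      linarith
  have h5 : r ^ s * r ^ (N * t) = r := by
    rw [← Real.rpow_add_of_nonneg hr hs0.le (by positivity), hst, Real.rpow_one]
  have h6 : 0 ≤ r ^ (1 / α) := by positivity
  rw [Real.mul_rpow (by positivity) hr, Real.mul_rpow hC he.le]
  calc C ^ s * e ^ s * r ^ s * (r ^ N + B) ^ t
      ≤ (1 + C) * e ^ (1 / α) * r ^ s * (r ^ (N * t) + (1 + B)) := by gcongr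
    _ = (1 + C) * e ^ (1 / α) * (r ^ s * r ^ (N * t) + (1 + B) * r ^ s) := by ring
    _ ≤ (1 + C) * e ^ (1 / α) * ((r + r ^ (1 / α)) + (1 + B) * (r + r ^ (1 / α))) := by
        rw [h5]
        gcongr
        linarith
    _ = _ := by ring

/-! ### Bounds on the transport distances -/

/-- For `α > p` the `p`-th moment can be interpolated between the first and an odd high moment
with a weight at least `p / α` on the first: the weight tends to `1` with the order of the high
moment. -/
theorem exists_interpolation_exponent {p : ℕ} {α : ℝ} (hp : 1 ≤ p) (hα : (p : ℝ) < α) :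
    ∃ (n : ℕ) (θ : ℝ), Odd (n + 2) ∧ 0 ≤ θ ∧ θ ≤ 1 ∧ θ + ((n + 2 : ℕ) : ℝ) * (1 - θ) = p ∧
      p / α ≤ θ := by
  have hp1 : (1 : ℝ) ≤ p := by exact_mod_cast hp
  have hα0 : 0 < α := by linarith
  have hd : 0 < α - p := sub_pos.2 hα
  obtain ⟨j, hj⟩ := exists_nat_gt (p * α / (α - p))
  rw [div_lt_iff₀ hd] at hj
  have hN : (0 : ℝ) < 2 * j + 2 := by positivity
  have key : (p : ℝ) / α ≤ (2 * j + 3 - p) / (2 * j + 2) := by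
    rw [div_le_div_iff₀ hα0 hN]
    nlinarith
  refine ⟨2 * j + 1, (2 * j + 3 - p) / (2 * j + 2), ⟨j + 1, by ring⟩,
    le_trans (by positivity) key, ?_, ?_, key⟩
  · rw [div_le_one hN]; linarith
  · push_cast
    field_simp
    ring

section Bounds

variable {E : Type*} [NormedAddCommGroup E] [InnerProductSpace ℝ E] [FiniteDimensional ℝ E]
  [MeasurableSpace E] [BorelSpace E]

instance isProbabilityMeasure_eulerMaruyamaLaw (γ : ℝ) (b : E → E) (hb : Measurable b) (k : ℕ)
    (x : E) : IsProbabilityMeasure (eulerMaruyamaLaw γ b hb k x) :=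
  (isMarkovKernel_pow (eulerMaruyama γ b hb) k).isProbabilityMeasure x

/-- The bound for the mixed cost, for every `R ≥ 0`; for `R = 0` its right-hand side is infinite
off the diagonal. -/
theorem wassersteinCost_mixedCost_le {R : ℝ} (hR : 0 ≤ R) {γ : ℝ} (hγ : 0 < γ) (hγ1 : γ ≤ 1)
    {b : E → E} (hb : Measurable b) {L : ℝ} (hL : 0 ≤ L)
    (hLip : ∀ x y, ‖b x - b y‖ ≤ L * ‖x - y‖) {C c : ℝ} (hC : 0 ≤ C) (hc : 0 ≤ c)
    (hmean : ∀ (k : ℕ) (p : E × E), ∫⁻ q, ENNReal.ofReal ‖q.1 - q.2‖ ∂((coupledChain γ b hb ^ k) p)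
      ≤ ENNReal.ofReal (C * Real.exp (-(c * (k * γ))) * ‖p.1 - p.2‖)) (k : ℕ) (x y : E) :
    wassersteinCost (mixedCost R) (eulerMaruyamaLaw γ b hb k x) (eulerMaruyamaLaw γ b hb k y)
      ≤ ENNReal.ofReal ((Real.exp (2 * c) + Real.exp (2 * c) * Real.exp (2 * L) * C * R + C)
          * Real.exp (-(c * (k * γ)))) * mixedCost R x y := by
  rcases eq_or_ne x y with rfl | hxy
  · rw [wassersteinCost_self fun z => by simp [mixedCost, offDiag]]
    exact zero_le
  set e := Real.exp (-(c * (k * γ))) with he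
  have he0 : 0 < e := Real.exp_pos _
  rcases hR.eq_or_lt with rfl | hR0
  · rw [mixedCost_zero_of_ne hxy, ENNReal.mul_top]
    · exact le_top
    · have : 0 < (Real.exp (2 * c) + Real.exp (2 * c) * Real.exp (2 * L) * C * 0 + C) * e := by
        positivity
      simpa using this
  refine (wassersteinCost_le γ b hb k x y _).trans ((lintegral_mixedCost_le R
    measurable_offDiag (by fun_prop)).trans ?_)
  have h1 := lintegral_offDiag_coupledChain_pow_le hγ hγ1 hb hL hLip hC hc hmean k (x, y)
  have h2 := hmean k (x, y)
  calc _ ≤ ENNReal.ofReal (Real.exp (2 * c) * e)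
          * (offDiag x y + ENNReal.ofReal (Real.exp (2 * L) * C * ‖x - y‖))
        + ENNReal.ofReal (C * e * ‖x - y‖) / ENNReal.ofReal R := by gcongr
    _ = ENNReal.ofReal (Real.exp (2 * c) * e) * offDiag x y
        + ENNReal.ofReal (((Real.exp (2 * c) * e) * (Real.exp (2 * L) * C) + C * e / R)
          * ‖x - y‖) := by
        rw [mul_add, add_assoc, ← ENNReal.ofReal_mul (by positivity),
          ← ENNReal.ofReal_div_of_pos hR0, ← ENNReal.ofReal_add (by positivity) (by positivity)]
        congr 2
        ring
    _ ≤ _ := by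
        refine le_mul_mixedCost hR0 (by positivity) (by positivity) ?_ ?_ x y
        · gcongr
          have : 0 ≤ Real.exp (2 * c) * Real.exp (2 * L) * C * R := by positivity
          linarith
        · have : (Real.exp (2 * c) * e * (Real.exp (2 * L) * C) + C * e / R) * R
              = (Real.exp (2 * c) * Real.exp (2 * L) * C * R + C) * e := by field_simp
          rw [this]
          gcongr
          have := Real.exp_pos (2 * c)
          linarith

theorem wassersteinDist_le_of_moments {γ : ℝ} {b : E → E} (hb : Measurable b) {C B e : ℝ}
    (hC : 0 ≤ C) (hB : 0 ≤ B) (he : 0 < e) (he1 : e ≤ 1) {N p : ℕ} {θ α : ℝ} (hp : 1 ≤ p)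
    (hα : (p : ℝ) < α) (hθ0 : 0 ≤ θ) (hθ1 : θ ≤ 1) (hθ : θ + N * (1 - θ) = p) (hθα : p / α ≤ θ)
    {k : ℕ} {x y : E}
    (h1 : ∫⁻ q, ENNReal.ofReal ‖q.1 - q.2‖ ∂((coupledChain γ b hb ^ k) (x, y))
      ≤ ENNReal.ofReal (C * e * ‖x - y‖))
    (h2 : ∫⁻ q, ENNReal.ofReal (‖q.1 - q.2‖ ^ N) ∂((coupledChain γ b hb ^ k) (x, y))
      ≤ ENNReal.ofReal (‖x - y‖ ^ N + B)) :
    wassersteinDist p (eulerMaruyamaLaw γ b hb k x) (eulerMaruyamaLaw γ b hb k y)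
      ≤ ENNReal.ofReal ((1 + C) * (2 + B) * e ^ (1 / α) * (‖x - y‖ + ‖x - y‖ ^ (1 / α))) := by
  have hp1 : (1 : ℝ) ≤ p := by exact_mod_cast hp
  have hp0 : (0 : ℝ) < p := by linarith
  have hα0 : 0 < α := by linarith
  have hθ1' : 0 ≤ 1 - θ := sub_nonneg.2 hθ1
  have hX : 0 ≤ C * e * ‖x - y‖ := by positivity
  have hY : 0 ≤ ‖x - y‖ ^ N + B := by positivity
  have hinterp := lintegral_pow_le_interpolation (ζ := (coupledChain γ b hb ^ k) (x, y))
    (r := fun q => ‖q.1 - q.2‖) (by fun_prop) (fun q => norm_nonneg _) hθ0 hθ1 hθ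
  calc wassersteinDist p (eulerMaruyamaLaw γ b hb k x) (eulerMaruyamaLaw γ b hb k y)
      ≤ (ENNReal.ofReal (C * e * ‖x - y‖) ^ θ
          * ENNReal.ofReal (‖x - y‖ ^ N + B) ^ (1 - θ)) ^ (1 / (p : ℝ)) := by
        refine ENNReal.rpow_le_rpow ((wassersteinCost_le γ b hb k x y _).trans
          (hinterp.trans ?_)) (by positivity)
        gcongr
    _ = ENNReal.ofReal ((C * e * ‖x - y‖) ^ (θ / p) * (‖x - y‖ ^ N + B) ^ ((1 - θ) / p)) := by
        rw [ENNReal.ofReal_rpow_of_nonneg hX hθ0, ENNReal.ofReal_rpow_of_nonneg hY hθ1',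
          ← ENNReal.ofReal_mul (by positivity),
          ENNReal.ofReal_rpow_of_nonneg (by positivity) (by positivity),
          Real.mul_rpow (by positivity) (by positivity), ← Real.rpow_mul hX, ← Real.rpow_mul hY,
          mul_one_div, mul_one_div]
    _ ≤ _ := by
        refine ENNReal.ofReal_le_ofReal (interpolated_moment_le hC hB he he1 (norm_nonneg _)
          (by linarith) ?_ ?_ (by positivity) ?_ ?_)
        · rw [div_le_div_iff₀ hα0 hp0, one_mul, ← div_le_iff₀ hα0]; exact hθα
        · rw [div_le_one hp0]; linarith
        · rw [div_le_one hp0]; linarith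
        · rw [← hθ]; rw [← hθ] at hp0; field_simp

end Bounds

theorem corollary2 (m mPlus L R : ℝ) (hmPlus : 0 < mPlus) (hL : 0 ≤ L) (hR : 0 ≤ R) :
    ∃ (γbar lam ρ D₁ D₂ E₀ E₁ E₂ : ℝ) (Eα : ℕ → ℝ → ℝ),
      0 < γbar ∧ 0 ≤ lam ∧ lam ≤ ρ ∧ ρ < 1 ∧
      0 ≤ D₁ ∧ 0 ≤ D₂ ∧ 0 ≤ E₀ ∧ 0 ≤ E₁ ∧ 0 ≤ E₂ ∧ (∀ p α, 0 ≤ Eα p α) ∧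
      ∀ (E : Type*) [NormedAddCommGroup E] [InnerProductSpace ℝ E] [FiniteDimensional ℝ E]
        [MeasurableSpace E] [BorelSpace E] (b : E → E)
        (hLip : ∀ x y, ‖b x - b y‖ ≤ L * ‖x - y‖),
        (∀ x y, ⟪b x - b y, x - y⟫ ≤ -m * ‖x - y‖ ^ 2) →
        (∀ x y, R ≤ ‖x - y‖ → ⟪b x - b y, x - y⟫ ≤ -mPlus * ‖x - y‖ ^ 2) →
        ∀ γ : ℝ, 0 < γ → γ ≤ γbar →
          ∀ (x y : E) (k : ℕ),
            -- the bound that defines the rate `ρ`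
            wassersteinCost (mixedCost R)
                (eulerMaruyamaLaw γ b (measurable_of_norm_sub_le hLip) k x)
                (eulerMaruyamaLaw γ b (measurable_of_norm_sub_le hLip) k y) ≤
                ENNReal.ofReal (lam ^ (k * γ / 4)) *
                  (ENNReal.ofReal D₁ * mixedCost R x y + ENNReal.ofReal D₂ * offDiag x y) +
                ENNReal.ofReal (E₀ * ρ ^ (k * γ / 4)) * offDiag x y ∧
            -- total variation and `W_c`
            tvDist
                (eulerMaruyamaLaw γ b (measurable_of_norm_sub_le hLip) k x)
                (eulerMaruyamaLaw γ b (measurable_of_norm_sub_le hLip) k y) ≤ wassersteinCost (mixedCost R)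
                (eulerMaruyamaLaw γ b (measurable_of_norm_sub_le hLip) k x)
                (eulerMaruyamaLaw γ b (measurable_of_norm_sub_le hLip) k y) ∧
            wassersteinCost (mixedCost R)
                (eulerMaruyamaLaw γ b (measurable_of_norm_sub_le hLip) k x)
                (eulerMaruyamaLaw γ b (measurable_of_norm_sub_le hLip) k y) ≤
                ENNReal.ofReal (E₁ * ρ ^ (k * γ / 4)) * mixedCost R x y ∧
            -- `W_1`
            wassersteinDist 1
                (eulerMaruyamaLaw γ b (measurable_of_norm_sub_le hLip) k x)
                (eulerMaruyamaLaw γ b (measurable_of_norm_sub_le hLip) k y) ≤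
                ENNReal.ofReal (E₂ * ρ ^ (k * γ / 4) * ‖x - y‖) ∧
            -- `W_p`
            ∀ (p : ℕ) (α : ℝ), 1 ≤ p → (p : ℝ) < α →
              wassersteinDist p
                (eulerMaruyamaLaw γ b (measurable_of_norm_sub_le hLip) k x)
                (eulerMaruyamaLaw γ b (measurable_of_norm_sub_le hLip) k y) ≤
                ENNReal.ofReal (Eα p α * ρ ^ (k * γ / (4 * α)) *
                  (‖x - y‖ + ‖x - y‖ ^ (1 / α))) := by
  obtain ⟨A, τ, C, c, hA, hτ, hc, hc1, hC, hFC, hcontr⟩ :=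
    exists_concave_contraction (R := R + 1) hL hmPlus
  have hmom := fun n => exists_moment_drift n hL hmPlus (R := R + 1) (by linarith)
  choose B hB hmom using hmom
  have hexp : ∀ (p : ℕ) (α : ℝ), ∃ (n : ℕ) (θ : ℝ), 1 ≤ p → (p : ℝ) < α → Odd (n + 2) ∧
      0 ≤ θ ∧ θ ≤ 1 ∧ θ + ((n + 2 : ℕ) : ℝ) * (1 - θ) = p ∧ p / α ≤ θ := fun p α => by
    by_cases h : 1 ≤ p ∧ (p : ℝ) < α
    · obtain ⟨n, θ, hnθ⟩ := exists_interpolation_exponent h.1 h.2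
      exact ⟨n, θ, fun _ _ => hnθ⟩
    · exact ⟨0, 0, fun h1 h2 => absurd ⟨h1, h2⟩ h⟩
  choose n θ hexp using hexp
  set E₁ := Real.exp (2 * c) + Real.exp (2 * c) * Real.exp (2 * L) * C * R + C with hE₁
  have hE₁0 : 0 ≤ E₁ := by positivity
  -- The first bound holds with the single rate `ρ` and without the terms of `D₂` and `E₀`. The
  -- value `ρ = exp (-4 c)` turns `ρ ^ (k γ / 4)` into `exp (-c k γ)`, an upper bound of
  -- `(1 - c γ) ^ k`.
  refine ⟨min 1 (min (1 / mPlus) (mPlus / (L ^ 2 + 1))), Real.exp (-(4 * c)),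
    Real.exp (-(4 * c)), E₁, 0, 0, E₁, C, fun p α => (1 + C) * (2 + B (n p α) / (mPlus / 4)),
    by positivity, (Real.exp_pos _).le, le_rfl, by rw [Real.exp_lt_one_iff]; linarith, hE₁0,
    le_rfl, le_rfl, hE₁0, hC, fun p α => ?_, ?_⟩
  · have := hB (n p α)
    positivity
  intro E _ _ _ _ _ b hLip _ hfar γ hγ hγbar x y k
  set hb := measurable_of_norm_sub_le hLip
  have hγ1 : γ ≤ 1 := hγbar.trans (min_le_left _ _)
  have hγm : γ * mPlus ≤ 1 := by
    rw [← le_div_iff₀ hmPlus]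
    exact hγbar.trans ((min_le_right _ _).trans (min_le_left _ _))
  have hγL : γ * L ^ 2 ≤ mPlus := by
    have h := hγbar.trans ((min_le_right _ _).trans (min_le_right _ _))
    rw [le_div_iff₀ (by positivity)] at h
    linarith
  have hnear := fun u v : E => norm_driftStep_sub_le hLip hγ.le u v
  have hfar' : ∀ u v : E, R + 1 ≤ ‖u - v‖ →
      ‖driftStep γ b u - driftStep γ b v‖ ≤ (1 - γ * mPlus / 2) * ‖u - v‖ := fun u v h =>
    norm_driftStep_sub_le_of_dissipative hLip hγ.le hγL hγm (hfar u v (by linarith))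
  have hκ : 0 ≤ 1 - c * γ := sub_nonneg.2 (mul_le_one₀ hc1 hγ.le hγ1)
  have hmean : ∀ (j : ℕ) (p : E × E),
      ∫⁻ q, ENNReal.ofReal ‖q.1 - q.2‖ ∂((coupledChain γ b hb ^ j) p)
        ≤ ENNReal.ofReal (C * Real.exp (-(c * (j * γ))) * ‖p.1 - p.2‖) := fun j p => by
    refine (lintegral_norm_sub_coupledChain_pow_le hγ hb hA hτ hκ hFC (fun u v =>
      hcontr γ _ _ hγ.le hγ1 (norm_nonneg _) (norm_nonneg _) (hnear u v) (hfar' u v)) j p).trans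
      (ENNReal.ofReal_le_ofReal ?_)
    have : (1 - c * γ) ^ j ≤ Real.exp (-(c * (j * γ))) := by
      calc (1 - c * γ) ^ j ≤ Real.exp (-(c * γ)) ^ j := by
            gcongr; exact Real.one_sub_le_exp_neg _
        _ = _ := by rw [← Real.exp_nat_mul]; ring_nf
    gcongr
  have hrate : Real.exp (-(4 * c)) ^ (k * γ / 4) = Real.exp (-(c * (k * γ))) := by
    rw [← Real.exp_mul]; ring_nf
  have hW := wassersteinCost_mixedCost_le hR hγ hγ1 hb hL hLip hC hc.le hmean k x y
  rw [← hE₁] at hW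
  have he1 : Real.exp (-(c * (k * γ))) ≤ 1 := Real.exp_le_one_iff.2 (by
    have : 0 ≤ c * (k * γ) := by positivity
    linarith)
  rw [hrate]
  refine ⟨?_, tvDist_le_wassersteinCost (offDiag_le_mixedCost R), hW, ?_, fun p α hp hα => ?_⟩
  · rw [ENNReal.ofReal_zero, zero_mul, zero_mul, ENNReal.ofReal_zero, zero_mul, add_zero, add_zero,
      ← mul_assoc, ← ENNReal.ofReal_mul (Real.exp_nonneg _), mul_comm (Real.exp _)]
    exact hW
  · have h := wassersteinCost_le γ b hb k x y (fun u v => ENNReal.ofReal ‖u - v‖)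
    simpa [wassersteinDist] using h.trans (hmean k (x, y))
  · obtain ⟨hodd, hθ0, hθ1, hθ, hθα⟩ := hexp p α hp hα
    have h2 := lintegral_pow_norm_sub_coupledChain_pow_le hγ hb hodd (a := mPlus / 4)
      (by positivity) (by linarith) (hB (n p α)) (fun u v =>
        hmom (n p α) γ _ _ hγ.le hγ1 hγm (norm_nonneg _) (norm_nonneg _) (hnear u v) (hfar' u v))
      k (x, y)
    have h := wassersteinDist_le_of_moments hb hC (div_nonneg (hB (n p α)) (by positivity))
      (Real.exp_pos _) he1 hp hα hθ0 hθ1 hθ hθα (hmean k (x, y)) h2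
    have hrate' : Real.exp (-(4 * c)) ^ (k * γ / (4 * α))
        = Real.exp (-(c * (k * γ))) ^ (1 / α) := by
      rw [← hrate, ← Real.rpow_mul (Real.exp_nonneg _)]
      congr 1
      rw [mul_one_div, div_div]
    rw [hrate']
    exact h
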